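/- Let $d\ge 1$. For $z=(x,\xi)\in\mathbb{R}^{2d}$ let $\pi(z)f(y)=e^{2\pi i\xi\cdot y}f(y-x)$ and let $Pf(y)=f(-y)$ on $L^2(\mathbb{R}^d)$. For a bounded operator $A$ on $L^2(\mathbb{R}^d)$ put $\alpha_z(A)=\pi(z)A\pi(z)^*$ and $\check A=PAP$. Let $\mathcal{S}^2$ be the Hilbert space of Hilbert–Schmidt operators on $L^2(\mathbb{R}^d)$, with inner product $\langle T,R\rangle=\operatorname{tr}(TR^*)$, and for $T,S\in\mathcal{S}^2$ put $T\star S(z)=\operatorname{tr}\big(T\alpha_z(\check S)\big)$, $z\in\mathbb{R}^{2d}$. Let $p\in[1,\infty)$, let $\Omega\subset\mathbb{R}^{2d}$ be measurable with $0<|\Omega|<\infty$, and let $S\in\mathcal{S}^2$. For all $T\in\mathcal{S}^2$ the functions $T\star\check S$ and $T\star\check T$ belong to $L^p(\Omega)$, and the following hold. (1) The supremum $$\sup_{T\in\mathcal{S}^2\setminus\{0\}}\frac{\left(\int_\Omega|T\star\check S(z)|^p\,dz\right)^{1/p}}{\|T\|_{\mathcal{S}^2}}$$ is finite and attained, and the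 functional $T\mapsto\left(\int_\Omega|T\star\check S(z)|^p\,dz\right)^{1/p}$ is sequentially weakly continuous on $\mathcal{S}^2$. (2) One has $$\sup_{T\in\mathcal{S}^2\setminus\{0\}}\frac{\left(\int_\Omega|T\star\check T(z)|^p\,dz\right)^{1/p}}{\|T\|_{\mathcal{S}^2}^2}=|\Omega|^{1/p},$$ and this supremum is not attained by any $T\in\mathcal{S}^2\setminus\{0\}$. -/

import Mathlib

open MeasureTheory Filter Topology
open scoped ENNReal InnerProductSpace

noncomputable section

namespace QHA

/-! ### Trace and Hilbert–Schmidt operators on a complex Hilbert space -/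

section Hilbert

variable {H : Type*} [NormedAddCommGroup H] [InnerProductSpace ℂ H] [CompleteSpace H]

/-- The index set of a fixed orthonormal basis of `H`. -/
def onbIndex (H : Type*) [NormedAddCommGroup H] [InnerProductSpace ℂ H] [CompleteSpace H] :
    Set H :=
  (exists_hilbertBasis ℂ H).choose

/-- A fixed orthonormal basis of `H`. Nothing below depends on its choice: see
`isHilbertSchmidt_iff`, `hsNorm_eq` and `hasSum_trace_mul`. -/
def onb (H : Type*) [NormedAddCommGroup H] [InnerProductSpace ℂ H] [CompleteSpace H] :
    HilbertBasis (onbIndex H) ℂ H :=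
  (exists_hilbertBasis ℂ H).choose_spec.choose

/-- The trace `∑ ⟨A e_i, e_i⟩` (Mathlib's inner product is linear in the second slot). -/
def trace (A : H →L[ℂ] H) : ℂ :=
  ∑' i, ⟪onb H i, A (onb H i)⟫_ℂ

/-- `T` is Hilbert–Schmidt, `T ∈ 𝒮²`: `tr (T* T) = ∑ ‖T e_i‖² < ∞`
(such an operator is automatically compact). -/
def IsHilbertSchmidt (T : H →L[ℂ] H) : Prop :=
  Summable fun i => ‖T (onb H i)‖ ^ 2

/-- The Hilbert–Schmidt norm `(tr (T* T))^{1/2} = (∑ ‖T e_i‖²)^{1/2}`. -/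
def hsNorm (T : H →L[ℂ] H) : ℝ :=
  Real.sqrt (∑' i, ‖T (onb H i)‖ ^ 2)

/-- The inner product `⟨T, R⟩ = tr (T R*)` of the Hilbert space `𝒮²`, linear in `T`. -/
def hsInner (T R : H →L[ℂ] H) : ℂ :=
  trace (T ∘L ContinuousLinearMap.adjoint R)

/-- Weak convergence `T_n ⇀ T` of a sequence in the Hilbert space `𝒮²`. -/
def HSWeakTendsto (T : ℕ → H →L[ℂ] H) (T₀ : H →L[ℂ] H) : Prop :=
  ∀ R : H →L[ℂ] H, IsHilbertSchmidt R →
    Tendsto (fun n => hsInner (T n) R) atTop (𝓝 (hsInner T₀ R))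

/-! #### Independence of the orthonormal basis -/

theorem hasSum_norm_inner_sq {ι : Type*} (b : HilbertBasis ι ℂ H) (x : H) :
    HasSum (fun i => ‖⟪b i, x⟫_ℂ‖ ^ 2) (‖x‖ ^ 2) := by
  have h := b.hasSum_inner_mul_inner x x
  have h2 := h.mapL (Complex.reCLM)
  simp only [Complex.reCLM_apply, inner_self_eq_norm_sq_to_K] at h2
  convert h2 using 1
  · funext i
    rw [← inner_conj_symm x (b i), mul_comm, Complex.mul_conj, Complex.normSq_eq_norm_sq,
      Complex.ofReal_re]
  · norm_cast

theorem hasSum_adjoint {ι κ : Type*} (b : HilbertBasis ι ℂ H) (c : HilbertBasis κ ℂ H)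
    (T : H →L[ℂ] H) {s : ℝ} (h : HasSum (fun i => ‖T (b i)‖ ^ 2) s) :
    HasSum (fun j => ‖ContinuousLinearMap.adjoint T (c j)‖ ^ 2) s ∧
      Summable fun q : ι × κ => ‖⟪c q.2, T (b q.1)⟫_ℂ‖ ^ 2 := by
  have hs : Summable fun q : ι × κ => ‖⟪c q.2, T (b q.1)⟫_ℂ‖ ^ 2 := by
    refine (summable_prod_of_nonneg fun q => sq_nonneg _).2
      ⟨fun i => (hasSum_norm_inner_sq c (T (b i))).summable, ?_⟩
    refine h.summable.congr fun i => ?_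
    exact (hasSum_norm_inner_sq c (T (b i))).tsum_eq.symm
  have h1 : HasSum (fun q : ι × κ => ‖⟪c q.2, T (b q.1)⟫_ℂ‖ ^ 2) s := by
    have h3 := hs.hasSum.prod_fiberwise fun i => hasSum_norm_inner_sq c (T (b i))
    rw [h.unique h3]
    exact hs.hasSum
  refine ⟨?_, hs⟩
  have h2 := (Equiv.prodComm κ ι).hasSum_iff.mpr h1
  refine h2.prod_fiberwise fun j => ?_
  have h4 := hasSum_norm_inner_sq b (ContinuousLinearMap.adjoint T (c j))
  have h5 : (fun i => ‖⟪b i, ContinuousLinearMap.adjoint T (c j)⟫_ℂ‖ ^ 2) =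
      fun i => ‖⟪c j, T (b i)⟫_ℂ‖ ^ 2 := by
    funext i
    rw [ContinuousLinearMap.adjoint_inner_right, ← inner_conj_symm, RCLike.norm_conj]
  rw [h5] at h4
  exact h4

theorem hasSum_basis {ι κ : Type*} (b : HilbertBasis ι ℂ H) (c : HilbertBasis κ ℂ H)
    (T : H →L[ℂ] H) {s : ℝ} (h : HasSum (fun i => ‖T (b i)‖ ^ 2) s) :
    HasSum (fun j => ‖T (c j)‖ ^ 2) s := by
  simpa using (hasSum_adjoint b c _ (hasSum_adjoint b b T h).1).1

theorem isHilbertSchmidt_iff {ι : Type*} (b : HilbertBasis ι ℂ H) (T : H →L[ℂ] H) :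
    IsHilbertSchmidt T ↔ Summable fun i => ‖T (b i)‖ ^ 2 :=
  ⟨fun h => (hasSum_basis _ b T h.hasSum).summable,
    fun h => (hasSum_basis b _ T h.hasSum).summable⟩

theorem hsNorm_eq {ι : Type*} (b : HilbertBasis ι ℂ H) {T : H →L[ℂ] H}
    (hT : IsHilbertSchmidt T) : hsNorm T = Real.sqrt (∑' i, ‖T (b i)‖ ^ 2) := by
  rw [hsNorm, (hasSum_basis _ b T hT.hasSum).tsum_eq]

theorem IsHilbertSchmidt.adjoint {T : H →L[ℂ] H} (hT : IsHilbertSchmidt T) :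
    IsHilbertSchmidt (ContinuousLinearMap.adjoint T) :=
  (hasSum_adjoint _ _ T hT.hasSum).1.summable

theorem IsHilbertSchmidt.comp_left {T : H →L[ℂ] H} (hT : IsHilbertSchmidt T) (B : H →L[ℂ] H) :
    IsHilbertSchmidt (B ∘L T) := by
  refine Summable.of_nonneg_of_le (fun _ => by positivity) (fun i => ?_) (hT.mul_left (‖B‖ ^ 2))
  rw [← mul_pow]
  exact pow_le_pow_left₀ (norm_nonneg _) (B.le_opNorm _) 2

theorem IsHilbertSchmidt.comp_right {T : H →L[ℂ] H} (hT : IsHilbertSchmidt T) (B : H →L[ℂ] H) :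
    IsHilbertSchmidt (T ∘L B) := by
  have := (hT.adjoint.comp_left (ContinuousLinearMap.adjoint B)).adjoint
  rwa [← ContinuousLinearMap.adjoint_comp, ContinuousLinearMap.adjoint_adjoint] at this

theorem hasSum_trace_swap {ι κ : Type*} (b : HilbertBasis ι ℂ H) (c : HilbertBasis κ ℂ H)
    {A B : H →L[ℂ] H} (hA : IsHilbertSchmidt A) (hB : IsHilbertSchmidt B) :
    ∃ s : ℂ, HasSum (fun i => ⟪b i, (A ∘L B) (b i)⟫_ℂ) s ∧
      HasSum (fun j => ⟪c j, (B ∘L A) (c j)⟫_ℂ) s := by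
  have h1 := (hasSum_adjoint b c _ (((isHilbertSchmidt_iff b _).1 hA.adjoint).hasSum)).2
  have h2 := (hasSum_adjoint b c _ (((isHilbertSchmidt_iff b _).1 hB).hasSum)).2
  have hs : Summable fun q : ι × κ =>
      ⟪ContinuousLinearMap.adjoint A (b q.1), c q.2⟫_ℂ * ⟪c q.2, B (b q.1)⟫_ℂ := by
    refine Summable.of_norm_bounded (h1.add h2) fun q => ?_
    rw [norm_mul, ← inner_conj_symm, RCLike.norm_conj]
    nlinarith [sq_nonneg (‖⟪c q.2, ContinuousLinearMap.adjoint A (b q.1)⟫_ℂ‖ -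
      ‖⟪c q.2, B (b q.1)⟫_ℂ‖), sq_nonneg (‖⟪c q.2, ContinuousLinearMap.adjoint A (b q.1)⟫_ℂ‖ +
      ‖⟪c q.2, B (b q.1)⟫_ℂ‖)]
  refine ⟨_, hs.hasSum.prod_fiberwise fun i => ?_,
    ((Equiv.prodComm κ ι).hasSum_iff.mpr hs.hasSum).prod_fiberwise fun j => ?_⟩
  · have := c.hasSum_inner_mul_inner (ContinuousLinearMap.adjoint A (b i)) (B (b i))
    rwa [ContinuousLinearMap.adjoint_inner_left] at this
  · have := b.hasSum_inner_mul_inner (ContinuousLinearMap.adjoint B (c j)) (A (c j))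
    rw [ContinuousLinearMap.adjoint_inner_left] at this
    have h5 : (fun i => ⟪ContinuousLinearMap.adjoint B (c j), b i⟫_ℂ * ⟪b i, A (c j)⟫_ℂ) =
        fun i => ⟪ContinuousLinearMap.adjoint A (b i), c j⟫_ℂ * ⟪c j, B (b i)⟫_ℂ := by
      funext i
      rw [ContinuousLinearMap.adjoint_inner_left, ContinuousLinearMap.adjoint_inner_left, mul_comm]
    rw [h5] at this
    exact this

/-- The trace of a product of two Hilbert–Schmidt operators is given by a convergent series, in
every orthonormal basis. -/
theorem hasSum_trace_mul {ι : Type*} (b : HilbertBasis ι ℂ H) {A B : H →L[ℂ] H}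
    (hA : IsHilbertSchmidt A) (hB : IsHilbertSchmidt B) :
    HasSum (fun i => ⟪b i, (A ∘L B) (b i)⟫_ℂ) (trace (A ∘L B)) := by
  obtain ⟨s, h1, h2⟩ := hasSum_trace_swap b (onb H) hA hB
  obtain ⟨t, h3, h4⟩ := hasSum_trace_swap (onb H) (onb H) hA hB
  rw [trace, h3.tsum_eq, h4.unique h2]
  exact h1

end Hilbert

/-! ### Time-frequency shifts and operator convolution on `L²(ℝᵈ)` -/

/-- Configuration space `ℝᵈ`. -/
abbrev Conf (d : ℕ) := EuclideanSpace ℝ (Fin d)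

/-- Phase space `ℝ²ᵈ`, with points `z = (x, ξ)` and Lebesgue measure. -/
abbrev Phase (d : ℕ) := Conf d × Conf d

/-- The Hilbert space `L²(ℝᵈ)`. -/
abbrev L2 (d : ℕ) := Lp ℂ 2 (volume : Measure (Conf d))

variable {d : ℕ}

/-- The pointwise formula `e^{2πi ξ·y} f(y - x)`. -/
def shiftFun (z : Phase d) (f : Conf d → ℂ) : Conf d → ℂ := fun y =>
  Complex.exp (2 * Real.pi * Complex.I * (⟪z.2, y⟫_ℝ : ℝ)) * f (y - z.1)

theorem norm_shiftFun (z : Phase d) (f : Conf d → ℂ) (y : Conf d) :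
    ‖shiftFun z f y‖ = ‖f (y - z.1)‖ := by
  rw [shiftFun, norm_mul, show 2 * (Real.pi : ℂ) * Complex.I * ((⟪z.2, y⟫_ℝ : ℝ) : ℂ)
    = ((2 * Real.pi * ⟪z.2, y⟫_ℝ : ℝ) : ℂ) * Complex.I by push_cast; ring,
    Complex.norm_exp_ofReal_mul_I, one_mul]

theorem aestronglyMeasurable_shiftFun (z : Phase d) {f : Conf d → ℂ}
    (hf : AEStronglyMeasurable f volume) : AEStronglyMeasurable (shiftFun z f) volume := by
  refine AEStronglyMeasurable.mul ?_
    (hf.comp_measurePreserving (measurePreserving_sub_right volume z.1))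
  exact Continuous.aestronglyMeasurable (by fun_prop)

theorem eLpNorm_shiftFun (z : Phase d) {f : Conf d → ℂ} (hf : AEStronglyMeasurable f volume) :
    eLpNorm (shiftFun z f) 2 volume = eLpNorm f 2 volume := by
  rw [← eLpNorm_comp_measurePreserving (p := 2) hf (measurePreserving_sub_right volume z.1)]
  exact eLpNorm_congr_norm_ae (Eventually.of_forall fun y => norm_shiftFun z f y)

theorem memLp_shiftFun (z : Phase d) (f : L2 d) : MemLp (shiftFun z f) 2 volume :=
  ⟨aestronglyMeasurable_shiftFun z (Lp.aestronglyMeasurable f), by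
    rw [eLpNorm_shiftFun z (Lp.aestronglyMeasurable f)]; exact (Lp.memLp f).2⟩

theorem shiftFun_congr (z : Phase d) {f g : Conf d → ℂ} (h : f =ᵐ[volume] g) :
    shiftFun z f =ᵐ[volume] shiftFun z g := by
  filter_upwards [(measurePreserving_sub_right volume z.1).quasiMeasurePreserving.ae h] with y hy
  simp only [shiftFun, hy]

/-- The time-frequency shift `π(z) f(y) = e^{2πi ξ·y} f(y - x)`, `z = (x, ξ)`, on `L²(ℝᵈ)`. -/
def tfShift (z : Phase d) : L2 d →L[ℂ] L2 d :=
  LinearIsometry.toContinuousLinearMap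
    { toFun := fun f => (memLp_shiftFun z f).toLp _
      map_add' := fun f g => by
        rw [← MemLp.toLp_add]
        refine MemLp.toLp_congr _ _ ((shiftFun_congr z (Lp.coeFn_add f g)).trans ?_)
        exact Eventually.of_forall fun y => by simp [shiftFun, mul_add]
      map_smul' := fun c f => by
        rw [RingHom.id_apply, ← MemLp.toLp_const_smul]
        refine MemLp.toLp_congr _ _ ((shiftFun_congr z (Lp.coeFn_smul c f)).trans ?_)
        exact Eventually.of_forall fun y => by simp [shiftFun, mul_left_comm]
      norm_map' := fun f => by
        change ‖(memLp_shiftFun z f).toLp _‖ = ‖f‖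
        rw [Lp.norm_toLp, eLpNorm_shiftFun z (Lp.aestronglyMeasurable f), Lp.norm_def] }

/-- The parity operator `P f(y) = f(-y)` on `L²(ℝᵈ)`. -/
def parity (d : ℕ) : L2 d →L[ℂ] L2 d :=
  (Lp.compMeasurePreservingₗᵢ ℂ (fun y : Conf d => -y)
    (Measure.measurePreserving_neg volume)).toContinuousLinearMap

/-- The operator shift `α_z(A) = π(z) A π(z)*`. -/
def opShift (z : Phase d) (A : L2 d →L[ℂ] L2 d) : L2 d →L[ℂ] L2 d :=
  tfShift z ∘L A ∘L ContinuousLinearMap.adjoint (tfShift z)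

/-- The operator reflection `Ǎ = P A P`. -/
def opReflect (A : L2 d →L[ℂ] L2 d) : L2 d →L[ℂ] L2 d :=
  parity d ∘L A ∘L parity d

/-- The operator convolution `(T ⋆ S)(z) = tr (T α_z(Š))`. -/
def opConv (T S : L2 d →L[ℂ] L2 d) (z : Phase d) : ℂ :=
  trace (T ∘L opShift z (opReflect S))

/-- For Hilbert–Schmidt `T` and `S` the operator convolution is well defined: the series for the
trace converges, to the same value in every orthonormal basis. -/
theorem hasSum_opConv {ι : Type*} (b : HilbertBasis ι ℂ (L2 d)) {T S : L2 d →L[ℂ] L2 d}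
    (hT : IsHilbertSchmidt T) (hS : IsHilbertSchmidt S) (z : Phase d) :
    HasSum (fun i => ⟪b i, T (opShift z (opReflect S) (b i))⟫_ℂ) (opConv T S z) :=
  hasSum_trace_mul b hT (((hS.comp_right _).comp_left _).comp_right _ |>.comp_left _)

/-- `(∫_Ω |F(z)|^p dz)^{1/p}`. -/
def localLpNorm (p : ℝ) (Ω : Set (Phase d)) (F : Phase d → ℂ) : ℝ :=
  (∫ z in Ω, ‖F z‖ ^ p) ^ (1 / p)

/-- The concentration functional `T ↦ ‖T ⋆ Š‖_{L^p(Ω)}` of the generalized Husimi problem. -/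
def husimiFunctional (p : ℝ) (Ω : Set (Phase d)) (S T : L2 d →L[ℂ] L2 d) : ℝ :=
  localLpNorm p Ω (opConv T (opReflect S))

/-- The quotient `‖T ⋆ Š‖_{L^p(Ω)} / ‖T‖_{𝒮²}`. -/
def husimiQuotient (p : ℝ) (Ω : Set (Phase d)) (S T : L2 d →L[ℂ] L2 d) : ℝ :=
  husimiFunctional p Ω S T / hsNorm T

/-- The quotient `‖T ⋆ Ť‖_{L^p(Ω)} / ‖T‖²_{𝒮²}` for the total correlation `T ⋆ Ť`. -/
def correlationQuotient (p : ℝ) (Ω : Set (Phase d)) (T : L2 d →L[ℂ] L2 d) : ℝ :=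
  localLpNorm p Ω (opConv T (opReflect T)) / hsNorm T ^ 2

/-- The set `𝒮² ∖ {0}` of admissible operators. -/
def admissible (d : ℕ) : Set (L2 d →L[ℂ] L2 d) :=
  {T | IsHilbertSchmidt T ∧ T ≠ 0}

end QHA

end

/-!
Write `α_z A = π(z) A π(z)*`. Since the two reflections in `T ⋆ Š` cancel,
`T ⋆ Š (z) = tr (T α_z S)`, and the Cauchy–Schwarz inequality in `𝒮²` bounds it by
`‖T‖ ‖S‖` uniformly in `z`. As `Ω` has finite measure, all `L^p(Ω)` norms are finite once
measurability is known; the latter follows by expanding the trace into matrix coefficients `⟨f, π(z) g⟩`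
in a countable basis (`measurable_opConv`).

*The Husimi problem.* `𝒮²` is identified with `ℓ²(H)` (`columns`). A weakly convergent sequence
`T_n` is bounded, and `tr (T_n α_z S)` converges for each `z`, so the functional converges by
dominated convergence (`tendsto_husimiFunctional`). The unit ball being weakly sequentially
compact, a normalized maximizing sequence yields a maximizer (`exists_isLUB_husimiQuotient`).

*The total correlation problem.* The tool is the Gabor orthonormal basis `g_k = π(k) 1_{(0,1]ᵈ}`,
`k ∈ ℤ²ᵈ`, whose completeness is Parseval's identity on the torus together with the tiling of `ℝᵈ`
by unit cubes. The upper bound `|Ω|^{1/p}` is the Cauchy–Schwarz inequality. It is approached by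
the projections `P_F` onto the span of `g_k`, `k ∈ F`: the commutation relations of the shifts
give `tr (P_F α_z P_F) = ∑_{i, k ∈ F} c_{i - k}(z)` with `c_m(z) = |⟨g_m, π(z) g_0⟩|²`
(`opConv_latticeProj`), and `∑_m c_m(z) = 1`. Since boxes in `ℤ²ᵈ` are a Følner sequence, this is
`|F| (1 + o(1)) = ‖P_F‖² (1 + o(1))` for each `z` (`tendsto_latticeBox_average`).

If `T` attained the bound, then `|tr (T α_z T)| = ‖T‖²` for almost every `z ∈ Ω`, hence
`α_z T ∈ ℂ T*` there, hence `α_{z - w} T ∈ ℂ T` for `z, w` in a set of positive measure.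
By Steinhaus' theorem this holds near `0`, and therefore for every shift. Then `‖T g_k‖ = ‖T g_0‖` for all `k`,
and `∑_k ‖T g_k‖² < ∞` forces `T = 0` (`correlationQuotient_ne`).
-/

noncomputable section

namespace QHA

/-! ### Weak sequential compactness in Hilbert spaces -/

section WeakCompactness

variable {E : Type*} [NormedAddCommGroup E] [InnerProductSpace ℂ E]

/-- Bounded sequences in a Hilbert space have weakly convergent subsequences. The space need not be
separable: only the closed span of the sequence matters, and the sequential Banach–Alaoglu theorem
applies there. -/
theorem exists_subseq_tendsto_inner [CompleteSpace E] (x : ℕ → E) {C : ℝ} (hx : ∀ n, ‖x n‖ ≤ C) :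
    ∃ (x₀ : E) (φ : ℕ → ℕ), StrictMono φ ∧
      ∀ y, Tendsto (fun n => ⟪x (φ n), y⟫_ℂ) atTop (𝓝 ⟪x₀, y⟫_ℂ) := by
  let V : Submodule ℂ E := (Submodule.span ℂ (Set.range x)).topologicalClosure
  have hVc : IsClosed (V : Set E) := Submodule.isClosed_topologicalClosure _
  have : CompleteSpace V := hVc.completeSpace_coe
  have hsep : TopologicalSpace.IsSeparable (V : Set E) := by
    rw [Submodule.topologicalClosure_coe]
    exact ((Set.countable_range x).isSeparable.span (R := ℂ)).closure
  have : TopologicalSpace.SeparableSpace V := hsep.separableSpace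
  have hxV : ∀ n, x n ∈ V := fun n =>
    Submodule.le_topologicalClosure _ (Submodule.subset_span ⟨n, rfl⟩)
  let ψ : ℕ → WeakDual ℂ V := fun n =>
    StrongDual.toWeakDual (InnerProductSpace.toDual ℂ V ⟨x n, hxV n⟩)
  have hψ : ∀ n, ψ n ∈ WeakDual.toStrongDual ⁻¹' Metric.closedBall (0 : StrongDual ℂ V) C := by
    intro n
    have h : ‖InnerProductSpace.toDual ℂ V ⟨x n, hxV n⟩‖ ≤ C := by
      rw [LinearIsometryEquiv.norm_map]
      exact hx n
    exact mem_closedBall_zero_iff.2 h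
  obtain ⟨f, -, φ, hφ, hlim⟩ := WeakDual.isSeqCompact_closedBall ℂ V (0 : StrongDual ℂ V) C hψ
  let x₀ : V := (InnerProductSpace.toDual ℂ V).symm (WeakDual.toStrongDual f)
  refine ⟨x₀, φ, hφ, fun y => ?_⟩
  have key : ∀ v : V, ⟪(v : E), y⟫_ℂ = ⟪v, V.orthogonalProjectionOnto y⟫_ℂ := fun v =>
    (Submodule.inner_orthogonalProjectionOnto_eq_of_mem_left v y).symm
  have h1 := ((WeakDual.eval_continuous (V.orthogonalProjectionOnto y)).tendsto f).comp hlim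
  have h2 : f (V.orthogonalProjectionOnto y) = ⟪(x₀ : E), y⟫_ℂ := by
    rw [key x₀]
    simp only [x₀]
    rw [InnerProductSpace.toDual_symm_apply]
    rfl
  rw [h2] at h1
  refine h1.congr fun n => ?_
  rw [key ⟨x (φ n), hxV _⟩]
  rfl

/-- A sequence whose inner products with every vector converge is bounded (uniform boundedness). -/
theorem exists_norm_le_of_tendsto_inner [CompleteSpace E] {x : ℕ → E} {x₀ : E}
    (h : ∀ y, Tendsto (fun n => ⟪x n, y⟫_ℂ) atTop (𝓝 ⟪x₀, y⟫_ℂ)) : ∃ C, ∀ n, ‖x n‖ ≤ C := by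
  obtain ⟨C, hC⟩ := banach_steinhaus (g := fun n => innerSL ℂ (x n)) fun y => by
    obtain ⟨C, hC⟩ := (h y).norm.bddAbove_range
    exact ⟨C, fun n => hC ⟨n, rfl⟩⟩
  exact ⟨C, fun n => by simpa using hC n⟩

/-- The norm is weakly lower semicontinuous. -/
theorem norm_le_of_tendsto_inner {x : ℕ → E} {x₀ : E} {C : ℝ} (hC : ∀ n, ‖x n‖ ≤ C)
    (h : ∀ y, Tendsto (fun n => ⟪x n, y⟫_ℂ) atTop (𝓝 ⟪x₀, y⟫_ℂ)) : ‖x₀‖ ≤ C := by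
  have h1 : ‖⟪x₀, x₀⟫_ℂ‖ ≤ C * ‖x₀‖ := le_of_tendsto' (h x₀).norm fun n =>
    (norm_inner_le_norm _ _).trans (mul_le_mul_of_nonneg_right (hC n) (norm_nonneg _))
  rw [inner_self_eq_norm_sq_to_K] at h1
  have h2 : ‖x₀‖ * ‖x₀‖ ≤ C * ‖x₀‖ := by simpa [sq] using h1
  rcases (norm_nonneg x₀).eq_or_lt with h0 | h0
  · rw [← h0]
    exact (norm_nonneg _).trans (hC 0)
  · exact le_of_mul_le_mul_right h2 h0

end WeakCompactness

/-! ### The Hilbert space of Hilbert–Schmidt operators -/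

section HilbertSchmidt

variable {H : Type*} [NormedAddCommGroup H] [InnerProductSpace ℂ H] [CompleteSpace H]

theorem hsNorm_nonneg (T : H →L[ℂ] H) : 0 ≤ hsNorm T := Real.sqrt_nonneg _

theorem hsNorm_adjoint {T : H →L[ℂ] H} (hT : IsHilbertSchmidt T) :
    hsNorm (ContinuousLinearMap.adjoint T) = hsNorm T := by
  rw [hsNorm, hsNorm, (hasSum_adjoint _ (onb H) T hT.hasSum).1.tsum_eq]

theorem IsHilbertSchmidt.smul {T : H →L[ℂ] H} (hT : IsHilbertSchmidt T) (c : ℂ) :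
    IsHilbertSchmidt (c • T) := by
  refine (hT.mul_left (‖c‖ ^ 2)).congr fun i => ?_
  rw [smul_apply, norm_smul, mul_pow]

theorem hsNorm_smul (c : ℂ) (T : H →L[ℂ] H) : hsNorm (c • T) = ‖c‖ * hsNorm T := by
  rw [hsNorm, hsNorm]
  simp only [smul_apply, norm_smul, mul_pow]
  rw [tsum_mul_left, Real.sqrt_mul (sq_nonneg _), Real.sqrt_sq (norm_nonneg _)]

theorem ext_onb {T R : H →L[ℂ] H} (h : ∀ i, T (onb H i) = R (onb H i)) : T = R := by
  refine ContinuousLinearMap.ext_on (s := Set.range (onb H)) ?_ ?_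
  · rw [Submodule.dense_iff_topologicalClosure_eq_top]
    exact (onb H).dense_span
  · rintro _ ⟨i, rfl⟩
    exact h i

/-- A Hilbert–Schmidt operator as the square-summable family of its values on the fixed orthonormal
basis. This identifies `𝒮²` with the Hilbert space `ℓ²(H)`. -/
def columns (T : H →L[ℂ] H) (hT : IsHilbertSchmidt T) : lp (fun _ : onbIndex H => H) 2 :=
  ⟨fun i => T (onb H i), by
    refine memℓp_gen ?_
    simpa [IsHilbertSchmidt] using hT⟩

@[simp]
theorem columns_apply (T : H →L[ℂ] H) (hT : IsHilbertSchmidt T) (i : onbIndex H) :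
    columns T hT i = T (onb H i) := rfl

theorem norm_columns (T : H →L[ℂ] H) (hT : IsHilbertSchmidt T) : ‖columns T hT‖ = hsNorm T := by
  rw [lp.norm_eq_tsum_rpow (by norm_num), hsNorm, Real.sqrt_eq_rpow]
  simp

/-- `ℓ²(H)` is exhausted by Hilbert–Schmidt operators: `a` comes from `x ↦ ∑ ⟨e_i, x⟩ a_i`, which is
obtained as the adjoint of `x ↦ ∑ ⟨a_i, x⟩ e_i`. -/
theorem exists_columns_eq (a : lp (fun _ : onbIndex H => H) 2) :
    ∃ (T : H →L[ℂ] H) (hT : IsHilbertSchmidt T), columns T hT = a := by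
  have ha : Summable fun i => ‖a i‖ ^ 2 := by
    simpa using (lp.memℓp a).summable (by norm_num)
  have hbd : ∀ (x : H) (i : onbIndex H), ‖⟪a i, x⟫_ℂ‖ ^ 2 ≤ ‖x‖ ^ 2 * ‖a i‖ ^ 2 := by
    intro x i
    rw [← mul_pow, mul_comm]
    exact pow_le_pow_left₀ (norm_nonneg _) (norm_inner_le_norm _ _) 2
  have hmem : ∀ x : H, Memℓp (fun i => ⟪a i, x⟫_ℂ) 2 := by
    intro x
    refine memℓp_gen ?_
    simpa using Summable.of_nonneg_of_le (fun _ => sq_nonneg _) (hbd x) (ha.mul_left (‖x‖ ^ 2))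
  let L : H →ₗ[ℂ] lp (fun _ : onbIndex H => ℂ) 2 :=
    { toFun := fun x => ⟨fun i => ⟪a i, x⟫_ℂ, hmem x⟩
      map_add' := fun x y => by
        ext i
        exact inner_add_right _ _ _
      map_smul' := fun c x => by
        ext i
        exact inner_smul_right _ _ _ }
  have hL : ∀ x, ‖L x‖ ≤ Real.sqrt (∑' i, ‖a i‖ ^ 2) * ‖x‖ := by
    intro x
    rw [lp.norm_eq_tsum_rpow (by norm_num)]
    have h2 : (2 : ℝ≥0∞).toReal = 2 := by norm_num
    simp only [h2, Real.rpow_two, ← Real.sqrt_eq_rpow]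
    refine Real.sqrt_le_iff.2 ⟨by positivity, ?_⟩
    rw [mul_pow, Real.sq_sqrt (tsum_nonneg fun _ => sq_nonneg _), mul_comm, ← tsum_mul_left]
    exact Summable.tsum_le_tsum (hbd x)
      (Summable.of_nonneg_of_le (fun _ => sq_nonneg _) (hbd x) (ha.mul_left (‖x‖ ^ 2)))
      (ha.mul_left _)
  let M : H →L[ℂ] H :=
    ((onb H).repr.symm.toContinuousLinearEquiv : _ →L[ℂ] H) ∘L (L.mkContinuous _ hL)
  have hM : ∀ i, ContinuousLinearMap.adjoint M (onb H i) = a i := by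
    intro i
    refine ext_inner_right ℂ fun x => ?_
    rw [ContinuousLinearMap.adjoint_inner_left]
    change ⟪onb H i, (onb H).repr.symm (L x)⟫_ℂ = _
    rw [← HilbertBasis.repr_apply_apply, LinearIsometryEquiv.apply_symm_apply]
    rfl
  refine ⟨ContinuousLinearMap.adjoint M, ?_, ?_⟩
  · simpa only [IsHilbertSchmidt, hM] using ha
  · ext i
    rw [columns_apply, hM]

theorem trace_comp_eq_inner {A B : H →L[ℂ] H} (hA : IsHilbertSchmidt A)
    (hB : IsHilbertSchmidt B) :
    trace (A ∘L B) = ⟪columns _ hA.adjoint, columns B hB⟫_ℂ := by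
  rw [lp.inner_eq_tsum, trace]
  simp only [columns_apply, ContinuousLinearMap.adjoint_inner_left,
    ContinuousLinearMap.comp_apply]

theorem norm_trace_comp_le {A B : H →L[ℂ] H} (hA : IsHilbertSchmidt A)
    (hB : IsHilbertSchmidt B) : ‖trace (A ∘L B)‖ ≤ hsNorm A * hsNorm B := by
  rw [trace_comp_eq_inner hA hB]
  refine (norm_inner_le_norm _ _).trans_eq ?_
  rw [norm_columns, norm_columns, hsNorm_adjoint hA]

theorem hsNorm_eq_zero_iff {T : H →L[ℂ] H} (hT : IsHilbertSchmidt T) : hsNorm T = 0 ↔ T = 0 := by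
  constructor
  · intro h
    rw [← norm_columns T hT, norm_eq_zero] at h
    refine ext_onb fun i => ?_
    rw [← columns_apply T hT, h]
    rfl
  · rintro rfl
    simp [hsNorm]

theorem hsNorm_pos {T : H →L[ℂ] H} (hT : IsHilbertSchmidt T) (h : T ≠ 0) : 0 < hsNorm T :=
  (hsNorm_nonneg T).lt_of_ne' (mt (hsNorm_eq_zero_iff hT).1 h)

/-- The equality case of the Cauchy–Schwarz inequality for the trace. -/
theorem exists_eq_smul_adjoint {A B : H →L[ℂ] H} (hA : IsHilbertSchmidt A)
    (hB : IsHilbertSchmidt B) (hA0 : A ≠ 0) (hB0 : B ≠ 0)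
    (h : ‖trace (A ∘L B)‖ = hsNorm A * hsNorm B) :
    ∃ c : ℂ, B = c • ContinuousLinearMap.adjoint A := by
  rw [trace_comp_eq_inner hA hB, ← hsNorm_adjoint hA, ← norm_columns _ hA.adjoint,
    ← norm_columns B hB] at h
  have h1 : columns _ hA.adjoint ≠ 0 := by
    rw [← norm_pos_iff, norm_columns, hsNorm_adjoint hA]
    exact hsNorm_pos hA hA0
  have h2 : columns B hB ≠ 0 := by
    rw [← norm_pos_iff, norm_columns]
    exact hsNorm_pos hB hB0
  obtain ⟨c, -, hc⟩ := (norm_inner_eq_norm_iff h1 h2).1 h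
  refine ⟨c, ext_onb fun i => ?_⟩
  rw [← columns_apply B hB, hc]
  rfl

theorem hsInner_eq_inner {T R : H →L[ℂ] H} (hT : IsHilbertSchmidt T)
    (hR : IsHilbertSchmidt R) :
    hsInner T R = ⟪columns _ hT.adjoint, columns _ hR.adjoint⟫_ℂ := by
  rw [hsInner, trace_comp_eq_inner hT hR.adjoint]

/-- Weak convergence in `𝒮²` is weak convergence in `ℓ²(H)` of the columns of the adjoints. -/
theorem hsWeakTendsto_iff {T : ℕ → H →L[ℂ] H} {T₀ : H →L[ℂ] H}
    (hT : ∀ n, IsHilbertSchmidt (T n)) (hT₀ : IsHilbertSchmidt T₀) :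
    HSWeakTendsto T T₀ ↔ ∀ y, Tendsto (fun n => ⟪columns _ (hT n).adjoint, y⟫_ℂ) atTop
      (𝓝 ⟪columns _ hT₀.adjoint, y⟫_ℂ) := by
  constructor
  · intro h y
    obtain ⟨R, hR, rfl⟩ := exists_columns_eq y
    have h1 := h _ hR.adjoint
    simp only [hsInner_eq_inner (hT _) hR.adjoint, hsInner_eq_inner hT₀ hR.adjoint,
      ContinuousLinearMap.adjoint_adjoint] at h1
    exact h1
  · intro h R hR
    simp only [hsInner_eq_inner (hT _) hR, hsInner_eq_inner hT₀ hR]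
    exact h _

theorem HSWeakTendsto.exists_hsNorm_le {T : ℕ → H →L[ℂ] H} {T₀ : H →L[ℂ] H}
    (hT : ∀ n, IsHilbertSchmidt (T n)) (hT₀ : IsHilbertSchmidt T₀) (h : HSWeakTendsto T T₀) :
    ∃ C, ∀ n, hsNorm (T n) ≤ C := by
  obtain ⟨C, hC⟩ := exists_norm_le_of_tendsto_inner ((hsWeakTendsto_iff hT hT₀).1 h)
  exact ⟨C, fun n => by simpa only [norm_columns, hsNorm_adjoint (hT n)] using hC n⟩

theorem HSWeakTendsto.tendsto_trace_comp {T : ℕ → H →L[ℂ] H} {T₀ : H →L[ℂ] H}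
    (h : HSWeakTendsto T T₀) {B : H →L[ℂ] H} (hB : IsHilbertSchmidt B) :
    Tendsto (fun n => trace (T n ∘L B)) atTop (𝓝 (trace (T₀ ∘L B))) := by
  simpa only [hsInner, ContinuousLinearMap.adjoint_adjoint] using h _ hB.adjoint

/-- The unit ball of `𝒮²` is weakly sequentially compact. -/
theorem exists_subseq_hsWeakTendsto {T : ℕ → H →L[ℂ] H} (hT : ∀ n, IsHilbertSchmidt (T n))
    {C : ℝ} (hC : ∀ n, hsNorm (T n) ≤ C) :
    ∃ T₀ : H →L[ℂ] H, IsHilbertSchmidt T₀ ∧ hsNorm T₀ ≤ C ∧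
      ∃ φ : ℕ → ℕ, StrictMono φ ∧ HSWeakTendsto (fun n => T (φ n)) T₀ := by
  have hC' : ∀ n, ‖columns _ (hT n).adjoint‖ ≤ C := fun n => by
    rw [norm_columns, hsNorm_adjoint (hT n)]
    exact hC n
  obtain ⟨a, φ, hφ, ha⟩ := exists_subseq_tendsto_inner _ hC'
  obtain ⟨R, hR, rfl⟩ := exists_columns_eq a
  have hle := norm_le_of_tendsto_inner (fun n => hC' (φ n)) ha
  rw [norm_columns] at hle
  refine ⟨_, hR.adjoint, by rwa [hsNorm_adjoint hR], φ, hφ, ?_⟩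
  rw [hsWeakTendsto_iff (fun n => hT (φ n)) hR.adjoint]
  simp only [ContinuousLinearMap.adjoint_adjoint]
  exact ha

/-- Hilbert–Schmidt norms are invariant under conjugation by isometries: the right factor `U*` is
handled by passing to adjoints. -/
theorem hsNorm_conj {U A : H →L[ℂ] H} (hA : IsHilbertSchmidt A) (hU : ∀ x, ‖U x‖ = ‖x‖) :
    hsNorm (U ∘L A ∘L ContinuousLinearMap.adjoint U) = hsNorm A := by
  have h1 : ∀ {V B : H →L[ℂ] H}, (∀ x, ‖V x‖ = ‖x‖) → hsNorm (V ∘L B) = hsNorm B := by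
    intro V B hV
    simp only [hsNorm, ContinuousLinearMap.comp_apply, hV]
  rw [h1 hU, ← hsNorm_adjoint (hA.comp_right _), ContinuousLinearMap.adjoint_comp,
    ContinuousLinearMap.adjoint_adjoint, h1 hU, hsNorm_adjoint hA]

end HilbertSchmidt

variable {d : ℕ}

/-! ### Time-frequency shifts -/

section TimeFrequencyShifts

theorem coeFn_tfShift (z : Phase d) (f : L2 d) : tfShift z f =ᵐ[volume] shiftFun z f :=
  (memLp_shiftFun z f).coeFn_toLp

theorem norm_tfShift (z : Phase d) (f : L2 d) : ‖tfShift z f‖ = ‖f‖ := by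
  change ‖(memLp_shiftFun z f).toLp _‖ = ‖f‖
  rw [Lp.norm_toLp, eLpNorm_shiftFun z (Lp.aestronglyMeasurable f), Lp.norm_def]

/-- The phase `e^{2πit}`. -/
def phase (t : ℝ) : ℂ := Complex.exp (2 * Real.pi * Complex.I * (t : ℂ))

theorem phase_add (s t : ℝ) : phase (s + t) = phase s * phase t := by
  rw [phase, phase, phase, ← Complex.exp_add]
  congr 1
  push_cast
  ring

theorem norm_phase (t : ℝ) : ‖phase t‖ = 1 := by
  rw [phase, show 2 * (Real.pi : ℂ) * Complex.I * (t : ℂ)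
    = ((2 * Real.pi * t : ℝ) : ℂ) * Complex.I by push_cast; ring,
    Complex.norm_exp_ofReal_mul_I]

theorem conj_phase_mul (t : ℝ) : (starRingEnd ℂ) (phase t) * phase t = 1 := by
  rw [Complex.conj_mul', norm_phase]
  simp

/-- Time-frequency shifts form a projective representation of phase space. -/
theorem tfShift_comp (z w : Phase d) (f : L2 d) :
    tfShift z (tfShift w f) = phase (-⟪w.2, z.1⟫_ℝ) • tfShift (z + w) f := by
  refine Lp.ext ?_
  filter_upwards [coeFn_tfShift z (tfShift w f), shiftFun_congr z (coeFn_tfShift w f),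
    Lp.coeFn_smul (phase (-⟪w.2, z.1⟫_ℝ)) (tfShift (z + w) f), coeFn_tfShift (z + w) f]
    with y h1 h2 h3 h4
  rw [h1, h2, h3, Pi.smul_apply, h4]
  change phase ⟪z.2, y⟫_ℝ * (phase ⟪w.2, y - z.1⟫_ℝ * f (y - z.1 - w.1)) =
    phase (-⟪w.2, z.1⟫_ℝ) * (phase ⟪(z + w).2, y⟫_ℝ * f (y - (z + w).1))
  rw [← mul_assoc, ← mul_assoc, ← phase_add, ← phase_add, Prod.snd_add, Prod.fst_add,
    inner_sub_right, inner_add_left, sub_sub]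
  congr 2
  ring

theorem tfShift_zero (f : L2 d) : tfShift 0 f = f := by
  refine Lp.ext ?_
  filter_upwards [coeFn_tfShift 0 f] with y h
  rw [h]
  simp [shiftFun]

theorem adjoint_tfShift_apply_tfShift (z : Phase d) (f : L2 d) :
    ContinuousLinearMap.adjoint (tfShift z) (tfShift z f) = f := by
  exact DFunLike.congr_fun
    ((ContinuousLinearMap.norm_map_iff_adjoint_comp_self _).1 (norm_tfShift z)) f

theorem tfShift_tfShift_neg (z : Phase d) (f : L2 d) :
    tfShift z (tfShift (-z) f) = phase ⟪z.2, z.1⟫_ℝ • f := by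
  rw [tfShift_comp, add_neg_cancel, tfShift_zero]
  simp

theorem phase_ne_zero (t : ℝ) : phase t ≠ 0 := Complex.exp_ne_zero _

theorem adjoint_tfShift_apply (z : Phase d) (f : L2 d) :
    ContinuousLinearMap.adjoint (tfShift z) f = (phase ⟪z.2, z.1⟫_ℝ)⁻¹ • tfShift (-z) f := by
  have h1 := congrArg (ContinuousLinearMap.adjoint (tfShift z)) (tfShift_tfShift_neg z f)
  rw [adjoint_tfShift_apply_tfShift, map_smul] at h1
  rw [h1, inv_smul_smul₀ (phase_ne_zero _)]

theorem tfShift_apply_adjoint_tfShift (z : Phase d) (f : L2 d) :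
    tfShift z (ContinuousLinearMap.adjoint (tfShift z) f) = f := by
  rw [adjoint_tfShift_apply, map_smul, tfShift_tfShift_neg, inv_smul_smul₀ (phase_ne_zero _)]

theorem opShift_zero (A : L2 d →L[ℂ] L2 d) : opShift 0 A = A := by
  have h : tfShift (0 : Phase d) = ContinuousLinearMap.id ℂ (L2 d) :=
    ContinuousLinearMap.ext tfShift_zero
  rw [opShift, h, ContinuousLinearMap.adjoint_id]
  rfl

/-- Conjugation by a composition of operators, up to a phase. -/
theorem conj_conj_eq {H : Type*} [NormedAddCommGroup H] [InnerProductSpace ℂ H] [CompleteSpace H]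
    {U V W : H →L[ℂ] H} {c : ℂ} (hc : (starRingEnd ℂ) c * c = 1)
    (h : ∀ f, U (V f) = c • W f) (A : H →L[ℂ] H) :
    U ∘L (V ∘L A ∘L ContinuousLinearMap.adjoint V) ∘L ContinuousLinearMap.adjoint U =
      W ∘L A ∘L ContinuousLinearMap.adjoint W := by
  ext1 f
  simp only [ContinuousLinearMap.comp_apply]
  have h1 : ContinuousLinearMap.adjoint V (ContinuousLinearMap.adjoint U f) =
      (starRingEnd ℂ) c • ContinuousLinearMap.adjoint W f := by
    refine ext_inner_right ℂ fun g => ?_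
    rw [ContinuousLinearMap.adjoint_inner_left, ContinuousLinearMap.adjoint_inner_left,
      h, inner_smul_left, inner_smul_right, ContinuousLinearMap.adjoint_inner_left,
      Complex.conj_conj]
  rw [h1, map_smul, map_smul, map_smul, h, smul_smul, hc, one_smul]

/-- The operator shifts form an action of phase space: the phases cancel. -/
theorem opShift_opShift (z w : Phase d) (A : L2 d →L[ℂ] L2 d) :
    opShift z (opShift w A) = opShift (z + w) A :=
  conj_conj_eq (conj_phase_mul _) (tfShift_comp z w) A

theorem opShift_smul (z : Phase d) (c : ℂ) (A : L2 d →L[ℂ] L2 d) :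
    opShift z (c • A) = c • opShift z A := by
  ext1 f
  simp [opShift]

theorem isHilbertSchmidt_opShift {A : L2 d →L[ℂ] L2 d} (hA : IsHilbertSchmidt A) (z : Phase d) :
    IsHilbertSchmidt (opShift z A) := (hA.comp_right _).comp_left _

theorem hsNorm_opShift {A : L2 d →L[ℂ] L2 d} (hA : IsHilbertSchmidt A) (z : Phase d) :
    hsNorm (opShift z A) = hsNorm A := hsNorm_conj hA (norm_tfShift z)

theorem opReflect_opReflect (A : L2 d →L[ℂ] L2 d) : opReflect (opReflect A) = A := by
  have h : ∀ f : L2 d, parity d (parity d f) = f := by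
    intro f
    refine Lp.ext ?_
    have h1 : ∀ g : L2 d, parity d g =ᵐ[volume] fun y => g (-y) := fun g =>
      Lp.coeFn_compMeasurePreserving g (Measure.measurePreserving_neg volume)
    have h2 := (Measure.measurePreserving_neg (volume : Measure (Conf d))).quasiMeasurePreserving.ae
      (h1 f)
    filter_upwards [h1 (parity d f), h2] with y h3 h4
    rw [h3, h4, neg_neg]
  ext1 f
  simp only [opReflect, ContinuousLinearMap.comp_apply, h]

/-- The two reflections in `T ⋆ Š` cancel. -/
theorem opConv_opReflect (T S : L2 d →L[ℂ] L2 d) (z : Phase d) :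
    opConv T (opReflect S) z = trace (T ∘L opShift z S) := by
  rw [opConv, opReflect_opReflect]

/-- Matrix coefficients of the time-frequency shifts are measurable, by Fubini. -/
theorem measurable_inner_tfShift (f g : L2 d) :
    Measurable fun z : Phase d => ⟪f, tfShift z g⟫_ℂ := by
  have hf := Lp.stronglyMeasurable f
  have hg := Lp.stronglyMeasurable g
  have h : StronglyMeasurable fun q : Phase d × Conf d => ⟪f q.2, shiftFun q.1 g q.2⟫_ℂ := by
    refine StronglyMeasurable.inner (hf.comp_measurable measurable_snd) ?_
    refine StronglyMeasurable.mul ?_ (hg.comp_measurable ?_)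
    · exact Continuous.stronglyMeasurable (by fun_prop)
    · exact Continuous.measurable (by fun_prop)
  have h1 := (h.integral_prod_right' (ν := (volume : Measure (Conf d)))).measurable
  convert h1 using 2 with z
  rw [L2.inner_def]
  refine integral_congr_ae ?_
  filter_upwards [coeFn_tfShift z g] with y hy
  rw [hy]

end TimeFrequencyShifts

/-! ### The Gabor orthonormal basis of the unit cube -/

section GaborBasis

/-- The half-open unit cube `(0, 1]ᵈ` in coordinates. -/
def coordCube (d : ℕ) : Set (Fin d → ℝ) := {x | ∀ i, x i ∈ Set.Ioc (0 : ℝ) (0 + 1)}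

theorem measurableSet_coordCube : MeasurableSet (coordCube d) :=
  MeasurableSet.univ_pi' fun _ => measurableSet_Ioc

theorem volume_coordCube : volume (coordCube d) = 1 := by
  have h : coordCube d = Set.pi Set.univ fun _ => Set.Ioc (0 : ℝ) (0 + 1) := by
    ext x
    simp [coordCube]
  rw [h, Real.volume_pi_Ioc]
  simp

/-- Parseval's identity for Fourier series on the unit cube. -/
theorem hasSum_sq_norm_fourier_coordCube {h : (Fin d → ℝ) → ℂ}
    (hh : MemLp h 2 (volume.restrict (coordCube d))) :
    HasSum (fun m : Fin d → ℤ => ‖∫ x in coordCube d,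
      UnitAddTorus.mFourier (-m) (fun i => (x i : UnitAddCircle)) * h x‖ ^ 2)
      (∫ x in coordCube d, ‖h x‖ ^ 2) := by
  let e := UnitAddTorus.measurableEquivPiIoc (fun _ : Fin d => (0 : ℝ))
  let F : UnitAddTorus (Fin d) → ℂ := fun t => h (e t).1
  have hF : ∀ x ∈ coordCube d, F (fun i => (x i : UnitAddCircle)) = h x := by
    intro x hx
    have h1 := e.apply_symm_apply ⟨x, hx⟩
    exact congrArg (fun y => h y.1) h1
  have h1 : MemLp (fun y : {x : Fin d → ℝ // ∀ i, x i ∈ Set.Ioc (0 : ℝ) (0 + 1)} => h y.1) 2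
      (Measure.comap Subtype.val volume) := by
    have h2 := (MeasurableEmbedding.subtype_coe
      (measurableSet_coordCube (d := d))).memLp_map_measure_iff (g := h) (p := 2)
      (μ := Measure.comap Subtype.val volume)
    refine h2.1 ?_
    rwa [map_comap_subtype_coe measurableSet_coordCube]
  have hFm := h1.comp_measurePreserving
    (UnitAddTorus.measurePreserving_equivPiIoc (fun _ : Fin d => (0 : ℝ)))
  have h3 := UnitAddTorus.hasSum_sq_mFourierCoeff (hFm.toLp _)
  have h4 := hFm.coeFn_toLp
  convert h3 using 1
  · funext m
    have h5 : UnitAddTorus.mFourierCoeff (hFm.toLp _) m = UnitAddTorus.mFourierCoeff F m := by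
      refine integral_congr_ae ?_
      filter_upwards [h4] with t ht
      rw [ht]
      rfl
    rw [h5, UnitAddTorus.mFourierCoeff_eq_integral F m (fun _ => 0)]
    congr 2
    refine setIntegral_congr_fun measurableSet_coordCube fun x hx => ?_
    simp only [hF x hx, smul_eq_mul]
  · have h6 := UnitAddTorus.integral_preimage (fun t => ‖F t‖ ^ 2) (fun _ : Fin d => (0 : ℝ))
    trans ∫ x in coordCube d, ‖F (fun i => (x i : UnitAddCircle))‖ ^ 2
    · refine setIntegral_congr_fun measurableSet_coordCube fun x hx => ?_
      simp only [hF x hx]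
    · refine h6.symm.trans ?_
      refine integral_congr_ae ?_
      filter_upwards [h4] with t ht
      rw [ht]
      rfl

/-- The half-open unit cube `(0, 1]ᵈ` in configuration space. -/
def unitCube (d : ℕ) : Set (Conf d) := WithLp.ofLp ⁻¹' coordCube d

theorem measurableSet_unitCube : MeasurableSet (unitCube d) :=
  (PiLp.volume_preserving_ofLp (Fin d)).measurable measurableSet_coordCube

theorem volume_unitCube : volume (unitCube d) = 1 := by
  rw [unitCube, (PiLp.volume_preserving_ofLp (Fin d)).measure_preimage
    measurableSet_coordCube.nullMeasurableSet, volume_coordCube]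

theorem setIntegral_unitCube {E : Type*} [NormedAddCommGroup E] [NormedSpace ℝ E]
    (f : Conf d → E) :
    ∫ y in unitCube d, f y = ∫ x in coordCube d, f (WithLp.toLp 2 x) :=
  ((PiLp.volume_preserving_ofLp (Fin d)).setIntegral_preimage_emb
    (MeasurableEquiv.toLp 2 (Fin d → ℝ)).symm.measurableEmbedding
    (fun x => f (WithLp.toLp 2 x)) (coordCube d))

/-- The integer vector `j` as a point of configuration space. -/
def intPoint (j : Fin d → ℤ) : Conf d := WithLp.toLp 2 fun i => (j i : ℝ)

theorem intPoint_sub (j k : Fin d → ℤ) : intPoint (j - k) = intPoint j - intPoint k := by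
  ext i
  simp [intPoint]

theorem hasSum_setIntegral_unitCube_add {f : Conf d → ℝ} (hf : Integrable f) :
    HasSum (fun j : Fin d → ℤ => ∫ y in unitCube d, f (y + intPoint j)) (∫ y, f y) := by
  have hm : ∀ j : Fin d → ℤ, MeasurableSet ((fun y => y - intPoint j) ⁻¹' unitCube d) := fun j =>
    measurableSet_unitCube.preimage (by fun_prop)
  have hceil : ∀ (y : Conf d) (j : Fin d → ℤ),
      y ∈ (fun y => y - intPoint j) ⁻¹' unitCube d ↔ ∀ i, ⌈y i⌉ = j i + 1 := by
    intro y j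
    refine forall_congr' fun i => ?_
    rw [Int.ceil_eq_iff]
    simp only [intPoint, PiLp.sub_apply, Set.mem_Ioc]
    push_cast
    constructor <;> rintro ⟨h1, h2⟩ <;> constructor <;> linarith
  have hd : Pairwise (Function.onFun Disjoint
      fun j : Fin d → ℤ => (fun y => y - intPoint j) ⁻¹' unitCube d) := by
    intro j k hjk
    refine Set.disjoint_left.2 fun y hj hk => hjk ?_
    funext i
    have h1 := (hceil y j).1 hj i
    have h2 := (hceil y k).1 hk i
    linarith
  have hU : (⋃ j : Fin d → ℤ, (fun y => y - intPoint j) ⁻¹' unitCube d) = Set.univ := by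
    refine Set.eq_univ_of_forall fun y => Set.mem_iUnion.2 ⟨fun i => ⌈y i⌉ - 1, ?_⟩
    rw [hceil]
    intro i
    ring
  have h := hasSum_integral_iUnion hm hd hf.integrableOn
  rw [hU, setIntegral_univ] at h
  refine h.congr_fun fun j => ?_
  have h1 := (measurePreserving_sub_right (volume : Measure (Conf d))
    (intPoint j)).setIntegral_preimage_emb
    (MeasurableEquiv.subRight (intPoint j)).measurableEmbedding
    (fun y => f (y + intPoint j)) (unitCube d)
  rw [← h1]
  simp

/-- The points of the lattice `ℤ²ᵈ` in phase space. -/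
def latticePoint (k : (Fin d → ℤ) × (Fin d → ℤ)) : Phase d := (intPoint k.1, intPoint k.2)

/-- The window `1_{(0,1]ᵈ}`. -/
def window (d : ℕ) : L2 d :=
  indicatorConstLp 2 (measurableSet_unitCube (d := d)) (by rw [volume_unitCube]; simp) (1 : ℂ)

theorem norm_window : ‖window d‖ = 1 := by
  rw [window, norm_indicatorConstLp (by norm_num) (by norm_num)]
  simp [Measure.real, volume_unitCube]

theorem conj_phase_inner_intPoint (m : Fin d → ℤ) (y : Conf d) :
    (starRingEnd ℂ) (phase ⟪intPoint m, y⟫_ℝ) =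
      UnitAddTorus.mFourier (-m) (fun i => ((y i : ℝ) : UnitAddCircle)) := by
  rw [UnitAddTorus.mFourier_neg]
  congr 1
  simp only [UnitAddTorus.mFourier, ContinuousMap.coe_mk, fourier_coe_apply]
  rw [← Complex.exp_sum, phase]
  congr 1
  rw [PiLp.inner_apply]
  simp only [intPoint, RCLike.inner_apply, conj_trivial]
  push_cast
  rw [Finset.mul_sum]
  refine Finset.sum_congr rfl fun i _ => ?_
  simp
  ring

/-- The coefficients of `g` in the Gabor system are, up to phases, the Fourier coefficients of the
integer translates of `g` on the unit cube. -/
theorem norm_inner_gabor (g : L2 d) (j m : Fin d → ℤ) :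
    ‖⟪tfShift (latticePoint (j, m)) (window d), g⟫_ℂ‖ =
      ‖∫ x in coordCube d, UnitAddTorus.mFourier (-m) (fun i => (x i : UnitAddCircle)) *
        g (WithLp.toLp 2 x + intPoint j)‖ := by
  have h1 : ⟪tfShift (latticePoint (j, m)) (window d), g⟫_ℂ =
      ∫ y, (starRingEnd ℂ) (shiftFun (latticePoint (j, m)) (window d) y) * g y := by
    rw [L2.inner_def]
    refine integral_congr_ae ?_
    filter_upwards [coeFn_tfShift (latticePoint (j, m)) (window d)] with y hy
    rw [hy, RCLike.inner_apply']
  have h2 : ∀ y, (starRingEnd ℂ) (shiftFun (latticePoint (j, m)) (window d) (y + intPoint j)) *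
      g (y + intPoint j) = (starRingEnd ℂ) (phase ⟪intPoint m, intPoint j⟫_ℝ) *
        ((starRingEnd ℂ) (window d y) *
        ((starRingEnd ℂ) (phase ⟪intPoint m, y⟫_ℝ) * g (y + intPoint j))) := by
    intro y
    have h3 : shiftFun (latticePoint (j, m)) (window d) (y + intPoint j) =
        phase ⟪intPoint m, y + intPoint j⟫_ℝ * window d (y + intPoint j - intPoint j) := rfl
    rw [h3, inner_add_right, phase_add, add_sub_cancel_right, map_mul, map_mul]
    ring
  have h4 : ∫ y, (starRingEnd ℂ) (window d y) *
      ((starRingEnd ℂ) (phase ⟪intPoint m, y⟫_ℝ) * g (y + intPoint j)) =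
      ∫ y in unitCube d, (starRingEnd ℂ) (phase ⟪intPoint m, y⟫_ℝ) * g (y + intPoint j) := by
    rw [← integral_indicator measurableSet_unitCube]
    refine integral_congr_ae ?_
    have h5 : window d =ᵐ[volume] (unitCube d).indicator fun _ => (1 : ℂ) :=
      indicatorConstLp_coeFn
    filter_upwards [h5] with y hy
    rw [hy]
    by_cases hyc : y ∈ unitCube d <;> simp [hyc]
  rw [h1, ← integral_add_right_eq_self _ (intPoint j)]
  simp only [h2]
  rw [integral_const_mul, h4, norm_mul, RCLike.norm_conj, norm_phase, one_mul,
    setIntegral_unitCube]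
  simp only [conj_phase_inner_intPoint]

/-- Parseval's identity for the Gabor system generated by the unit cube and the lattice `ℤ²ᵈ`. -/
theorem hasSum_sq_norm_inner_gabor (g : L2 d) :
    HasSum (fun k => ‖⟪tfShift (latticePoint k) (window d), g⟫_ℂ‖ ^ 2) (‖g‖ ^ 2) := by
  have hgi : Integrable (fun y => ‖g y‖ ^ 2) volume :=
    (memLp_two_iff_integrable_sq_norm (Lp.aestronglyMeasurable g)).1 (Lp.memLp g)
  have hnorm : ∫ y, ‖g y‖ ^ 2 = ‖g‖ ^ 2 := by
    have h1 := inner_self_eq_norm_sq (𝕜 := ℂ) g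
    rw [L2.inner_def, ← integral_re (L2.integrable_inner g g)] at h1
    rw [← h1]
    refine integral_congr_ae (Eventually.of_forall fun y => ?_)
    exact (inner_self_eq_norm_sq (𝕜 := ℂ) (g y)).symm
  have hrow : ∀ j : Fin d → ℤ,
      HasSum (fun m => ‖⟪tfShift (latticePoint (j, m)) (window d), g⟫_ℂ‖ ^ 2)
        (∫ y in unitCube d, ‖g (y + intPoint j)‖ ^ 2) := by
    intro j
    have hmem : MemLp (fun x : Fin d → ℝ => g (WithLp.toLp 2 x + intPoint j)) 2 volume :=
      ((Lp.memLp g).comp_measurePreserving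
        (measurePreserving_add_right volume (intPoint j))).comp_measurePreserving
        (PiLp.volume_preserving_toLp (Fin d))
    have h1 := hasSum_sq_norm_fourier_coordCube (hmem.restrict (coordCube d))
    simp only [norm_inner_gabor]
    rw [setIntegral_unitCube]
    exact h1
  have hcol := hasSum_setIntegral_unitCube_add hgi
  rw [hnorm] at hcol
  have hs : Summable fun k : (Fin d → ℤ) × (Fin d → ℤ) =>
      ‖⟪tfShift (latticePoint k) (window d), g⟫_ℂ‖ ^ 2 := by
    refine (summable_prod_of_nonneg fun k => sq_nonneg _).2 ⟨fun j => (hrow j).summable, ?_⟩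
    exact hcol.summable.congr fun j => (hrow j).tsum_eq.symm
  rw [← (hs.hasSum.prod_fiberwise hrow).unique hcol]
  exact hs.hasSum

/-- Unit vectors satisfying Parseval's identity are orthonormal: Parseval's identity for `v k` has
the term `‖⟪v k, v k⟫‖² = 1`, which leaves nothing for the others. -/
theorem orthonormal_of_hasSum {E ι : Type*} [NormedAddCommGroup E] [InnerProductSpace ℂ E]
    {v : ι → E} (h1 : ∀ k, ‖v k‖ = 1) (h : ∀ x, HasSum (fun k => ‖⟪v k, x⟫_ℂ‖ ^ 2) (‖x‖ ^ 2)) :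
    Orthonormal ℂ v := by
  classical
  refine ⟨h1, fun k l hkl => ?_⟩
  have h2 := sum_le_hasSum {k, l} (fun _ _ => sq_nonneg _) (h (v l))
  rw [Finset.sum_pair hkl, inner_self_eq_norm_sq_to_K, h1] at h2
  have h3 : ‖⟪v k, v l⟫_ℂ‖ ^ 2 ≤ 0 := by simpa using h2
  exact norm_eq_zero.1 (pow_eq_zero_iff two_ne_zero |>.1 (le_antisymm h3 (sq_nonneg _)))

theorem exists_hilbertBasis_of_hasSum {E ι : Type*} [NormedAddCommGroup E] [InnerProductSpace ℂ E]
    [CompleteSpace E] {v : ι → E} (h1 : ∀ k, ‖v k‖ = 1)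
    (h : ∀ x, HasSum (fun k => ‖⟪v k, x⟫_ℂ‖ ^ 2) (‖x‖ ^ 2)) :
    ∃ b : HilbertBasis ι ℂ E, ⇑b = v := by
  refine ⟨HilbertBasis.mkOfOrthogonalEqBot (orthonormal_of_hasSum h1 h) ?_,
    HilbertBasis.coe_mkOfOrthogonalEqBot _ _⟩
  refine (Submodule.eq_bot_iff _).2 fun x hx => ?_
  have h2 : ∀ k, ⟪v k, x⟫_ℂ = 0 := fun k =>
    (Submodule.mem_orthogonal _ _).1 hx _ (Submodule.subset_span ⟨k, rfl⟩)
  have h3 := h x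
  simp only [h2, norm_zero, ne_eq, OfNat.ofNat_ne_zero, not_false_eq_true, zero_pow] at h3
  exact norm_eq_zero.1 (pow_eq_zero_iff two_ne_zero |>.1 (h3.unique hasSum_zero))

/-- The Gabor orthonormal basis of `L²(ℝᵈ)`: the time-frequency shifts of `1_{(0,1]ᵈ}` along the
lattice `ℤ²ᵈ`. -/
def gabor (d : ℕ) : HilbertBasis ((Fin d → ℤ) × (Fin d → ℤ)) ℂ (L2 d) :=
  (exists_hilbertBasis_of_hasSum (v := fun k => tfShift (latticePoint k) (window d))
    (fun k => by rw [norm_tfShift, norm_window]) hasSum_sq_norm_inner_gabor).choose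

theorem gabor_apply (k : (Fin d → ℤ) × (Fin d → ℤ)) :
    gabor d k = tfShift (latticePoint k) (window d) :=
  congrFun (exists_hilbertBasis_of_hasSum (v := fun k => tfShift (latticePoint k) (window d))
    (fun k => by rw [norm_tfShift, norm_window]) hasSum_sq_norm_inner_gabor).choose_spec k

end GaborBasis

/-! ### Bounds and measurability of operator convolutions -/

section OperatorConvolution

theorem measurable_of_hasSum {Z ι : Type*} [MeasurableSpace Z] [Countable ι] {f : ι → Z → ℂ}
    {g : Z → ℂ} (hf : ∀ i, Measurable (f i)) (h : ∀ z, HasSum (fun i => f i z) (g z)) :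
    Measurable g :=
  measurable_of_tendsto_metrizable' (atTop : Filter (Finset ι))
    (f := fun s z => ∑ i ∈ s, f i z) (fun s => Finset.measurable_fun_sum s fun i _ => hf i)
    (tendsto_pi_nhds.2 h)

theorem hasSum_inner_conj {H ι : Type*} [NormedAddCommGroup H] [InnerProductSpace ℂ H]
    [CompleteSpace H] (b : HilbertBasis ι ℂ H) (U S : H →L[ℂ] H) (f g : H) :
    HasSum (fun k => ⟪f, U (b k)⟫_ℂ * ⟪U (ContinuousLinearMap.adjoint S (b k)), g⟫_ℂ)
      ⟪f, (U ∘L S ∘L ContinuousLinearMap.adjoint U) g⟫_ℂ := by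
  have h := b.hasSum_inner_mul_inner (ContinuousLinearMap.adjoint U f)
    (S (ContinuousLinearMap.adjoint U g))
  simp only [ContinuousLinearMap.adjoint_inner_left] at h
  refine h.congr_fun fun k => ?_
  rw [← ContinuousLinearMap.adjoint_inner_right, ContinuousLinearMap.adjoint_inner_left]

theorem measurable_inner_opShift (S : L2 d →L[ℂ] L2 d) (f g : L2 d) :
    Measurable fun z : Phase d => ⟪f, opShift z S g⟫_ℂ := by
  refine measurable_of_hasSum (fun k => ?_) fun z => hasSum_inner_conj (gabor d) (tfShift z) S f g
  refine (measurable_inner_tfShift f (gabor d k)).mul ?_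
  have h := measurable_inner_tfShift g (ContinuousLinearMap.adjoint S (gabor d k))
  have h1 := (Complex.continuous_conj.measurable).comp h
  simpa only [Function.comp_def, inner_conj_symm] using h1

theorem measurable_opConv {T S : L2 d →L[ℂ] L2 d} (hT : IsHilbertSchmidt T)
    (hS : IsHilbertSchmidt S) : Measurable (opConv T (opReflect S)) := by
  have h : ∀ z, HasSum (fun i => ⟪ContinuousLinearMap.adjoint T (gabor d i),
      opShift z S (gabor d i)⟫_ℂ) (opConv T (opReflect S) z) := by
    intro z
    rw [opConv_opReflect]
    refine (hasSum_trace_mul (gabor d) hT (isHilbertSchmidt_opShift hS z)).congr_fun fun i => ?_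
    rw [ContinuousLinearMap.adjoint_inner_left]
    rfl
  exact measurable_of_hasSum (fun i => measurable_inner_opShift S _ _) h

theorem norm_opConv_le {T S : L2 d →L[ℂ] L2 d} (hT : IsHilbertSchmidt T)
    (hS : IsHilbertSchmidt S) (z : Phase d) :
    ‖opConv T (opReflect S) z‖ ≤ hsNorm T * hsNorm S := by
  rw [opConv_opReflect, ← hsNorm_opShift hS z]
  exact norm_trace_comp_le hT (isHilbertSchmidt_opShift hS z)

theorem memLp_opConv {T S : L2 d →L[ℂ] L2 d} (hT : IsHilbertSchmidt T)
    (hS : IsHilbertSchmidt S) {Ω : Set (Phase d)} (hΩ : volume Ω < ∞) (q : ℝ≥0∞) :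
    MemLp (opConv T (opReflect S)) q (volume.restrict Ω) := by
  have : IsFiniteMeasure (volume.restrict Ω) := ⟨by rwa [Measure.restrict_apply_univ]⟩
  exact MemLp.of_bound (measurable_opConv hT hS).aestronglyMeasurable _
    (Eventually.of_forall (norm_opConv_le hT hS))

end OperatorConvolution

/-! ### Local `L^p` norms of bounded functions -/

section LocalNorm

variable {p : ℝ} {Ω : Set (Phase d)}

theorem integrableOn_norm_rpow (hp : 0 ≤ p) (hΩ : volume Ω < ∞) {F : Phase d → ℂ}
    (hF : Measurable F) {C : ℝ} (hC : ∀ z, ‖F z‖ ≤ C) :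
    IntegrableOn (fun z => ‖F z‖ ^ p) Ω := by
  refine Measure.integrableOn_of_bounded hΩ.ne (hF.norm.pow_const p).aestronglyMeasurable
    (M := C ^ p) (Eventually.of_forall fun z => ?_)
  rw [Real.norm_of_nonneg (by positivity)]
  exact Real.rpow_le_rpow (norm_nonneg _) (hC z) hp

theorem localLpNorm_const (hp : 0 < p) {C : ℝ} (hC : 0 ≤ C) :
    localLpNorm p Ω (fun _ => (C : ℂ)) = C * (volume Ω).toReal ^ (1 / p) := by
  rw [localLpNorm, setIntegral_const, Complex.norm_real, Real.norm_of_nonneg hC, smul_eq_mul,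
    mul_comm, Real.mul_rpow (by positivity) (by positivity), one_div,
    Real.rpow_rpow_inv hC hp.ne']
  rfl

theorem localLpNorm_le (hp : 0 < p) (hΩ : volume Ω < ∞) {F : Phase d → ℂ}
    (hF : Measurable F) {C : ℝ} (hC : ∀ z, ‖F z‖ ≤ C) :
    localLpNorm p Ω F ≤ C * (volume Ω).toReal ^ (1 / p) := by
  have h0 : 0 ≤ C := (norm_nonneg _).trans (hC 0)
  rw [← localLpNorm_const hp h0]
  refine Real.rpow_le_rpow (integral_nonneg fun z => by positivity) ?_ (by positivity)
  refine integral_mono (integrableOn_norm_rpow hp.le hΩ hF hC)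
    (integrableOn_norm_rpow hp.le hΩ measurable_const fun _ => le_rfl) fun z => ?_
  refine Real.rpow_le_rpow (norm_nonneg _) ?_ hp.le
  rw [Complex.norm_real, Real.norm_of_nonneg h0]
  exact hC z

theorem localLpNorm_nonneg (F : Phase d → ℂ) : 0 ≤ localLpNorm p Ω F :=
  Real.rpow_nonneg (integral_nonneg fun _ => by positivity) _

theorem localLpNorm_const_mul (hp : 0 < p) (c : ℂ) (F : Phase d → ℂ) :
    localLpNorm p Ω (fun z => c * F z) = ‖c‖ * localLpNorm p Ω F := by
  simp only [localLpNorm, norm_mul, Real.mul_rpow (norm_nonneg _) (norm_nonneg _)]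
  rw [integral_const_mul, Real.mul_rpow (by positivity) (integral_nonneg fun _ => by positivity),
    one_div, Real.rpow_rpow_inv (norm_nonneg _) hp.ne']

theorem tendsto_localLpNorm (hp : 0 < p) (hΩ : volume Ω < ∞) {F : ℕ → Phase d → ℂ}
    {F₀ : Phase d → ℂ} (hF : ∀ n, Measurable (F n)) {C : ℝ} (hC : ∀ n z, ‖F n z‖ ≤ C)
    (h : ∀ z, Tendsto (fun n => F n z) atTop (𝓝 (F₀ z))) :
    Tendsto (fun n => localLpNorm p Ω (F n)) atTop (𝓝 (localLpNorm p Ω F₀)) := by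
  refine Tendsto.rpow_const ?_ (Or.inr (by positivity))
  refine tendsto_integral_of_dominated_convergence (fun _ => C ^ p)
    (fun n => ((hF n).norm.pow_const p).aestronglyMeasurable)
    (integrableOn_const hΩ.ne) (fun n => Eventually.of_forall fun z => ?_)
    (Eventually.of_forall fun z => (h z).norm.rpow_const (Or.inr hp.le))
  rw [Real.norm_of_nonneg (by positivity)]
  exact Real.rpow_le_rpow (norm_nonneg _) (hC n z) hp.le

/-- A function bounded by `C` whose `L^p(Ω)` norm is that of the constant `C` has modulus `C` almost
everywhere on `Ω`. -/
theorem ae_norm_eq_of_localLpNorm_eq (hp : 0 < p) (hΩ : volume Ω < ∞) {F : Phase d → ℂ}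
    (hF : Measurable F) {C : ℝ} (hC : ∀ z, ‖F z‖ ≤ C)
    (h : localLpNorm p Ω F = C * (volume Ω).toReal ^ (1 / p)) :
    ∀ᵐ z ∂volume.restrict Ω, ‖F z‖ = C := by
  have h0 : 0 ≤ C := (norm_nonneg _).trans (hC 0)
  have hi := integrableOn_norm_rpow hp.le hΩ hF hC
  have h1 : ∫ z in Ω, ‖F z‖ ^ p = ∫ z in Ω, C ^ p := by
    rw [← localLpNorm_const hp h0, localLpNorm, localLpNorm, Real.rpow_left_inj
      (integral_nonneg fun _ => by positivity) (integral_nonneg fun _ => by positivity)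
      (by positivity)] at h
    simpa [abs_of_nonneg h0] using h
  have hc : IntegrableOn (fun _ : Phase d => C ^ p) Ω := integrableOn_const hΩ.ne
  have h2 : ∫ z in Ω, (C ^ p - ‖F z‖ ^ p) = 0 := by
    rw [integral_sub hc hi, h1, sub_self]
  rw [integral_eq_zero_iff_of_nonneg (fun z => sub_nonneg.2
    (Real.rpow_le_rpow (norm_nonneg _) (hC z) hp.le))
    (hc.sub hi)] at h2
  filter_upwards [h2] with z hz
  exact ((Real.rpow_left_inj h0 (norm_nonneg _) hp.ne').1 (sub_eq_zero.1 hz)).symm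

end LocalNorm

/-! ### Projections onto spans of Gabor basis vectors -/

section LatticeProjection

/-- The orthogonal projection onto the span of the Gabor basis vectors with index in `F`: a
localization operator with sharp cutoff on a set of lattice points. -/
def latticeProj (F : Finset ((Fin d → ℤ) × (Fin d → ℤ))) : L2 d →L[ℂ] L2 d :=
  ∑ k ∈ F, InnerProductSpace.rankOne ℂ (gabor d k) (gabor d k)

variable (F : Finset ((Fin d → ℤ) × (Fin d → ℤ)))

theorem latticeProj_apply (f : L2 d) :
    latticeProj F f = ∑ k ∈ F, ⟪gabor d k, f⟫_ℂ • gabor d k := by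
  simp [latticeProj]

theorem latticeProj_gabor [DecidableEq ((Fin d → ℤ) × (Fin d → ℤ))]
    (i : (Fin d → ℤ) × (Fin d → ℤ)) :
    latticeProj F (gabor d i) = if i ∈ F then gabor d i else 0 := by
  simp [latticeProj_apply, orthonormal_iff_ite.1 (gabor d).orthonormal]

theorem inner_latticeProj (f : L2 d) :
    ⟪f, latticeProj F f⟫_ℂ = ((∑ k ∈ F, ‖⟪gabor d k, f⟫_ℂ‖ ^ 2 : ℝ) : ℂ) := by
  rw [latticeProj_apply, inner_sum]
  push_cast
  refine Finset.sum_congr rfl fun k _ => ?_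
  rw [inner_smul_right, ← inner_conj_symm f, Complex.mul_conj']

theorem adjoint_latticeProj :
    ContinuousLinearMap.adjoint (latticeProj F) = latticeProj F := by
  simp [latticeProj]

theorem hasSum_latticeProj : HasSum (fun i => ‖latticeProj F (gabor d i)‖ ^ 2) (F.card : ℝ) := by
  classical
  have h : ∀ i, ‖latticeProj F (gabor d i)‖ ^ 2 = if i ∈ F then (1 : ℝ) else 0 := by
    intro i
    rw [latticeProj_gabor]
    split_ifs <;> simp [(gabor d).orthonormal.1]
  simp only [h]
  have h1 : HasSum (fun i => if i ∈ F then (1 : ℝ) else 0)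
      (∑ i ∈ F, if i ∈ F then (1 : ℝ) else 0) :=
    hasSum_sum_of_ne_finset_zero fun i hi => by simp [hi]
  simpa using h1

theorem isHilbertSchmidt_latticeProj : IsHilbertSchmidt (latticeProj F) :=
  (isHilbertSchmidt_iff (gabor d) _).2 (hasSum_latticeProj F).summable

theorem hsNorm_latticeProj_sq : hsNorm (latticeProj F) ^ 2 = F.card := by
  rw [hsNorm_eq (gabor d) (isHilbertSchmidt_latticeProj F), (hasSum_latticeProj F).tsum_eq,
    Real.sq_sqrt (Nat.cast_nonneg _)]

theorem latticeProj_mem_admissible (hF : F.Nonempty) : latticeProj F ∈ admissible d := by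
  refine ⟨isHilbertSchmidt_latticeProj F, fun h => ?_⟩
  have h1 := hsNorm_latticeProj_sq F
  rw [h, (hsNorm_eq_zero_iff (by simpa [h] using isHilbertSchmidt_latticeProj F)).2 rfl] at h1
  have h2 := hF.card_pos
  have h3 : (0 : ℝ) < F.card := by exact_mod_cast h2
  norm_num at h1
  linarith

end LatticeProjection

/-! ### The generalized Husimi problem -/

section Husimi

variable {p : ℝ} {Ω : Set (Phase d)} {S : L2 d →L[ℂ] L2 d}

theorem tendsto_husimiFunctional (hp : 0 < p) (hΩ : volume Ω < ∞) (hS : IsHilbertSchmidt S)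
    {T : ℕ → L2 d →L[ℂ] L2 d} {T₀ : L2 d →L[ℂ] L2 d} (hT : ∀ n, IsHilbertSchmidt (T n))
    (hT₀ : IsHilbertSchmidt T₀) (h : HSWeakTendsto T T₀) :
    Tendsto (fun n => husimiFunctional p Ω S (T n)) atTop (𝓝 (husimiFunctional p Ω S T₀)) := by
  obtain ⟨C, hC⟩ := h.exists_hsNorm_le hT hT₀
  refine tendsto_localLpNorm hp hΩ (C := C * hsNorm S) (fun n => measurable_opConv (hT n) hS)
    (fun n z => (norm_opConv_le (hT n) hS z).trans
      (mul_le_mul_of_nonneg_right (hC n) (hsNorm_nonneg S))) fun z => ?_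
  simp only [opConv_opReflect]
  exact h.tendsto_trace_comp (isHilbertSchmidt_opShift hS z)

theorem trace_smul {H : Type*} [NormedAddCommGroup H] [InnerProductSpace ℂ H] [CompleteSpace H]
    (c : ℂ) (A : H →L[ℂ] H) : trace (c • A) = c * trace A := by
  simp only [trace, smul_apply, inner_smul_right, tsum_mul_left]

theorem husimiFunctional_smul (hp : 0 < p) (c : ℂ) (T : L2 d →L[ℂ] L2 d) :
    husimiFunctional p Ω S (c • T) = ‖c‖ * husimiFunctional p Ω S T := by
  rw [husimiFunctional, husimiFunctional, ← localLpNorm_const_mul hp]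
  congr 1
  funext z
  rw [opConv, opConv, ContinuousLinearMap.smul_comp, trace_smul]

theorem husimiQuotient_nonneg (T : L2 d →L[ℂ] L2 d) : 0 ≤ husimiQuotient p Ω S T :=
  div_nonneg (localLpNorm_nonneg _) (hsNorm_nonneg T)

/-- A maximizing sequence on the unit sphere has a weak limit point in the unit ball, at which the
weakly continuous functional takes the supremum as its value. -/
theorem exists_isLUB_husimiQuotient (hp : 0 < p) (hΩ : volume Ω < ∞) (hS : IsHilbertSchmidt S) :
    ∃ T₀ ∈ admissible d,
      IsLUB (husimiQuotient p Ω S '' admissible d) (husimiQuotient p Ω S T₀) := by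
  have hne : (admissible d).Nonempty := ⟨_, latticeProj_mem_admissible {0} (by simp)⟩
  have hbdd : BddAbove (husimiQuotient p Ω S '' admissible d) := by
    refine ⟨hsNorm S * (volume Ω).toReal ^ (1 / p), ?_⟩
    rintro _ ⟨T, hT, rfl⟩
    rw [husimiQuotient, div_le_iff₀ (hsNorm_pos hT.1 hT.2)]
    refine (localLpNorm_le hp hΩ (measurable_opConv hT.1 hS) (norm_opConv_le hT.1 hS)).trans_eq ?_
    ring
  have hlub := isLUB_csSup (hne.image _) hbdd
  obtain ⟨u, -, hu, hmem⟩ := exists_seq_tendsto_sSup (hne.image _) hbdd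
  set M := sSup (husimiQuotient p Ω S '' admissible d)
  choose T hT hTu using hmem
  have hpos : ∀ n, 0 < hsNorm (T n) := fun n => hsNorm_pos (hT n).1 (hT n).2
  let R : ℕ → L2 d →L[ℂ] L2 d := fun n => (((hsNorm (T n))⁻¹ : ℝ) : ℂ) • T n
  have hR : ∀ n, IsHilbertSchmidt (R n) := fun n => (hT n).1.smul _
  have hc : ∀ n, ‖(((hsNorm (T n))⁻¹ : ℝ) : ℂ)‖ = (hsNorm (T n))⁻¹ := fun n => by
    rw [Complex.norm_real, Real.norm_of_nonneg (inv_nonneg.2 (hpos n).le)]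
  have hR1 : ∀ n, hsNorm (R n) ≤ 1 := fun n => by
    rw [hsNorm_smul, hc, inv_mul_cancel₀ (hpos n).ne']
  have hRu : ∀ n, husimiFunctional p Ω S (R n) = u n := fun n => by
    rw [husimiFunctional_smul hp, hc, ← hTu n, husimiQuotient, inv_mul_eq_div]
  obtain ⟨T₀, hT₀, hT₀1, φ, hφ, hw⟩ := exists_subseq_hsWeakTendsto hR hR1
  have hlim := tendsto_husimiFunctional hp hΩ hS (fun n => hR (φ n)) hT₀ hw
  simp only [hRu] at hlim
  have hM : husimiFunctional p Ω S T₀ = M :=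
    tendsto_nhds_unique hlim (hu.comp hφ.tendsto_atTop)
  by_cases h0 : T₀ = 0
  · -- The supremum is then `0`, so that every admissible operator attains it.
    have hM0 : M = 0 := by
      rw [← hM, h0, ← zero_smul ℂ (0 : L2 d →L[ℂ] L2 d), husimiFunctional_smul hp, norm_zero,
        zero_mul]
    refine ⟨T 0, hT 0, ?_⟩
    have h1 := hlub.1 ⟨T 0, hT 0, rfl⟩
    rw [le_antisymm (h1.trans_eq hM0) (husimiQuotient_nonneg _), ← hM0]
    exact hlub
  · refine ⟨T₀, ⟨hT₀, h0⟩, ?_⟩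
    have h1 : M ≤ husimiQuotient p Ω S T₀ := by
      rw [husimiQuotient, le_div_iff₀ (hsNorm_pos hT₀ h0), hM]
      refine mul_le_of_le_one_right ?_ hT₀1
      rw [← hM]
      exact localLpNorm_nonneg _
    rw [le_antisymm (hlub.1 ⟨T₀, ⟨hT₀, h0⟩, rfl⟩) h1]
    exact hlub

end Husimi

/-! ### Averages over lattice boxes -/

section Averages

/-- The lattice points with all coordinates in `[-N, N]`. -/
def latticeBox (d N : ℕ) : Finset ((Fin d → ℤ) × (Fin d → ℤ)) :=
  Finset.Icc (fun _ => -(N : ℤ)) (fun _ => (N : ℤ)) ×ˢ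
    Finset.Icc (fun _ => -(N : ℤ)) (fun _ => (N : ℤ))

theorem mem_latticeBox {N : ℕ} {k : (Fin d → ℤ) × (Fin d → ℤ)} :
    k ∈ latticeBox d N ↔ (∀ i, |k.1 i| ≤ N) ∧ ∀ i, |k.2 i| ≤ N := by
  simp only [latticeBox, Finset.mem_product, Finset.mem_Icc, Pi.le_def, abs_le, forall_and]

theorem card_latticeBox (N : ℕ) : (latticeBox d N).card = (2 * N + 1) ^ (2 * d) := by
  have h : (((N : ℤ) + 1 - -(N : ℤ)).toNat) = 2 * N + 1 := by omega
  have h1 : (Finset.Icc (fun _ : Fin d => -(N : ℤ)) (fun _ => (N : ℤ))).card =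
      (2 * N + 1) ^ d := by
    rw [Pi.card_Icc]
    simp only [Int.card_Icc, h, Finset.prod_const, Finset.card_univ, Fintype.card_fin]
  rw [latticeBox, Finset.card_product, h1, two_mul d, pow_add]

theorem sub_mem_latticeBox {M N : ℕ} {k l : (Fin d → ℤ) × (Fin d → ℤ)}
    (hk : k ∈ latticeBox d M) (hl : l ∈ latticeBox d N) : k - l ∈ latticeBox d (M + N) := by
  rw [mem_latticeBox] at *
  push_cast
  exact ⟨fun i => (abs_sub _ _).trans (add_le_add (hk.1 i) (hl.1 i)),
    fun i => (abs_sub _ _).trans (add_le_add (hk.2 i) (hl.2 i))⟩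

theorem tendsto_latticeBox : Tendsto (latticeBox d) atTop atTop := by
  refine tendsto_atTop_finset_of_monotone ?_ fun k => ?_
  · intro M N hMN k hk
    rw [mem_latticeBox] at *
    have h : (M : ℤ) ≤ N := by exact_mod_cast hMN
    exact ⟨fun i => (hk.1 i).trans h, fun i => (hk.2 i).trans h⟩
  · refine ⟨∑ i, ((k.1 i).natAbs + (k.2 i).natAbs), mem_latticeBox.2 ?_⟩
    have h : ∀ i, (k.1 i).natAbs + (k.2 i).natAbs ≤
        ∑ i, ((k.1 i).natAbs + (k.2 i).natAbs) := fun i =>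
      Finset.single_le_sum (f := fun i => (k.1 i).natAbs + (k.2 i).natAbs)
        (fun _ _ => Nat.zero_le _) (Finset.mem_univ i)
    refine ⟨fun i => ?_, fun i => ?_⟩ <;>
    · rw [Int.abs_eq_natAbs, Int.ofNat_le]
      exact le_trans (by omega) (h i)

/-- Averages of a summable function over differences of lattice points in large boxes converge to
its sum, since boxes form a Følner sequence. The estimate from below keeps the rows with index in
the smaller box of size `R²`, each of which contains all differences of size `R`. -/
theorem tendsto_latticeBox_average {c : (Fin d → ℤ) × (Fin d → ℤ) → ℝ} (hc : ∀ k, 0 ≤ c k)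
    (h : HasSum c 1) :
    Tendsto (fun R : ℕ => (∑ i ∈ latticeBox d (R ^ 2 + R), ∑ k ∈ latticeBox d (R ^ 2 + R),
      c (i - k)) / (latticeBox d (R ^ 2 + R)).card) atTop (𝓝 1) := by
  have hcard : ∀ N : ℕ, (0 : ℝ) < (latticeBox d N).card := fun N => by
    rw [card_latticeBox]
    positivity
  have hratio : Tendsto (fun R : ℕ => ((latticeBox d (R ^ 2)).card : ℝ) /
      (latticeBox d (R ^ 2 + R)).card) atTop (𝓝 1) := by
    have h1 : Tendsto (fun R : ℕ => 1 - 2 * ((R : ℝ) / (2 * (R ^ 2 + R) + 1))) atTop (𝓝 1) := by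
      have h2 : Tendsto (fun R : ℕ => (R : ℝ) / (2 * (R ^ 2 + R) + 1)) atTop (𝓝 0) := by
        refine squeeze_zero (fun R => by positivity) (fun R => ?_)
          (tendsto_one_div_add_atTop_nhds_zero_nat (𝕜 := ℝ))
        rw [div_le_div_iff₀ (by positivity) (by positivity)]
        nlinarith [(Nat.cast_nonneg R : (0 : ℝ) ≤ R)]
      simpa using (h2.const_mul 2).const_sub 1
    have h3 := h1.pow (2 * d)
    rw [one_pow] at h3
    refine h3.congr fun R => ?_
    rw [card_latticeBox, card_latticeBox]
    push_cast
    rw [← div_pow]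
    congr 1
    field_simp
    ring
  have hsum : Tendsto (fun R : ℕ => ∑ m ∈ latticeBox d R, c m) atTop (𝓝 1) :=
    Tendsto.comp (g := fun s : Finset _ => ∑ m ∈ s, c m) h tendsto_latticeBox
  have hlow := hratio.mul hsum
  rw [one_mul] at hlow
  refine tendsto_of_tendsto_of_tendsto_of_le_of_le hlow tendsto_const_nhds (fun R => ?_)
    fun R => ?_
  · rw [div_mul_eq_mul_div]
    refine div_le_div_of_nonneg_right ?_ (hcard _).le
    have hsub : latticeBox d (R ^ 2) ⊆ latticeBox d (R ^ 2 + R) := by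
      intro k hk
      rw [mem_latticeBox] at *
      push_cast at *
      exact ⟨fun i => (hk.1 i).trans (by linarith [Int.natCast_nonneg R]),
        fun i => (hk.2 i).trans (by linarith [Int.natCast_nonneg R])⟩
    rw [← nsmul_eq_mul, ← Finset.sum_const]
    refine (Finset.sum_le_sum fun i hi => ?_).trans
      (Finset.sum_le_sum_of_subset_of_nonneg hsub fun i _ _ => Finset.sum_nonneg fun k _ => hc _)
    have hinj : ∑ m ∈ latticeBox d R, c m =
        ∑ k ∈ (latticeBox d R).image fun m => i - m, c (i - k) := by
      rw [Finset.sum_image fun a _ b _ hab => sub_right_injective hab]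
      simp only [sub_sub_cancel]
    rw [hinj]
    refine Finset.sum_le_sum_of_subset_of_nonneg ?_ fun _ _ _ => hc _
    exact Finset.image_subset_iff.2 fun m hm => sub_mem_latticeBox hi hm
  · refine div_le_one_of_le₀ ?_ (hcard _).le
    refine (Finset.sum_le_card_nsmul _ _ 1 fun i _ => ?_).trans_eq (by simp)
    rw [← Finset.sum_image (f := c) (g := fun k => i - k)
      (fun a _ b _ hab => sub_right_injective hab)]
    exact sum_le_hasSum _ (fun _ _ => hc _) h

end Averages

/-! ### The supremum in the total correlation problem -/

section Correlation

/-- The squared modulus of the matrix coefficient of a time-frequency shift between the window and a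
Gabor basis vector. -/
def gaborCoeff (z : Phase d) (m : (Fin d → ℤ) × (Fin d → ℤ)) : ℝ :=
  ‖⟪gabor d m, tfShift z (window d)⟫_ℂ‖ ^ 2

theorem hasSum_gaborCoeff (z : Phase d) : HasSum (gaborCoeff z) 1 := by
  have h := hasSum_norm_inner_sq (gabor d) (tfShift z (window d))
  rwa [norm_tfShift, norm_window, one_pow] at h

theorem norm_inner_smul_smul {H : Type*} [NormedAddCommGroup H] [InnerProductSpace ℂ H] {a b : ℂ}
    (ha : ‖a‖ = 1) (hb : ‖b‖ = 1) (f g : H) : ‖⟪a • f, b • g⟫_ℂ‖ = ‖⟪f, g⟫_ℂ‖ := by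
  rw [inner_smul_left, inner_smul_right, norm_mul, norm_mul, RCLike.norm_conj, ha, hb, one_mul,
    one_mul]

theorem inner_tfShift_tfShift (z : Phase d) (f g : L2 d) :
    ⟪tfShift z f, tfShift z g⟫_ℂ = ⟪f, g⟫_ℂ := by
  rw [← ContinuousLinearMap.adjoint_inner_right, adjoint_tfShift_apply_tfShift]

theorem norm_inner_tfShift_add (a b c : Phase d) (f g : L2 d) :
    ‖⟪tfShift (c + a) f, tfShift (c + b) g⟫_ℂ‖ = ‖⟪tfShift a f, tfShift b g⟫_ℂ‖ := by
  rw [← inner_tfShift_tfShift c (tfShift a f), tfShift_comp c a f, tfShift_comp c b g,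
    norm_inner_smul_smul (norm_phase _) (norm_phase _)]

theorem latticePoint_sub (i k : (Fin d → ℤ) × (Fin d → ℤ)) :
    latticePoint (i - k) = latticePoint i - latticePoint k :=
  Prod.ext (intPoint_sub _ _) (intPoint_sub _ _)

/-- The matrix coefficients of time-frequency shifts in the Gabor basis depend, up to phases, on
differences of lattice points only. -/
theorem sq_norm_inner_gabor_adjoint (z : Phase d) (i k : (Fin d → ℤ) × (Fin d → ℤ)) :
    ‖⟪gabor d k, ContinuousLinearMap.adjoint (tfShift z) (gabor d i)⟫_ℂ‖ ^ 2 =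
      gaborCoeff z (i - k) := by
  have h1 : ‖⟪tfShift z (tfShift (latticePoint k) (window d)),
      tfShift (latticePoint i) (window d)⟫_ℂ‖ =
      ‖⟪tfShift (z + latticePoint k) (window d), tfShift (latticePoint i) (window d)⟫_ℂ‖ := by
    have h2 := norm_inner_smul_smul (norm_phase (-⟪(latticePoint k).2, z.1⟫_ℝ)) (norm_one (α := ℂ))
      (tfShift (z + latticePoint k) (window d)) (tfShift (latticePoint i) (window d))
    rwa [← tfShift_comp, one_smul] at h2
  have h3 := norm_inner_tfShift_add z (latticePoint (i - k)) (latticePoint k) (window d) (window d)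
  rw [latticePoint_sub, add_sub_cancel, add_comm] at h3
  rw [gaborCoeff, ContinuousLinearMap.adjoint_inner_right, gabor_apply, gabor_apply, gabor_apply,
    h1, h3, norm_inner_symm, latticePoint_sub]

/-- The correlation of a lattice projection counts differences of lattice points, weighted by
`gaborCoeff`. -/
theorem opConv_latticeProj (F : Finset ((Fin d → ℤ) × (Fin d → ℤ))) (z : Phase d) :
    opConv (latticeProj F) (opReflect (latticeProj F)) z =
      ((∑ i ∈ F, ∑ k ∈ F, gaborCoeff z (i - k) : ℝ) : ℂ) := by
  classical
  rw [opConv_opReflect]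
  have h := hasSum_trace_mul (gabor d) (isHilbertSchmidt_latticeProj F)
    (isHilbertSchmidt_opShift (isHilbertSchmidt_latticeProj F) z)
  have h1 : ∀ i, ⟪gabor d i, (latticeProj F ∘L opShift z (latticeProj F)) (gabor d i)⟫_ℂ =
      if i ∈ F then ((∑ k ∈ F, gaborCoeff z (i - k) : ℝ) : ℂ) else 0 := by
    intro i
    rw [ContinuousLinearMap.comp_apply, ← ContinuousLinearMap.adjoint_inner_left,
      adjoint_latticeProj, latticeProj_gabor]
    split_ifs
    · rw [opShift, ContinuousLinearMap.comp_apply, ContinuousLinearMap.comp_apply,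
        ← ContinuousLinearMap.adjoint_inner_left, inner_latticeProj]
      simp only [sq_norm_inner_gabor_adjoint]
    · exact inner_zero_left _
  simp only [h1] at h
  have h2 : HasSum (fun i => if i ∈ F then ((∑ k ∈ F, gaborCoeff z (i - k) : ℝ) : ℂ) else 0)
      (∑ i ∈ F, if i ∈ F then ((∑ k ∈ F, gaborCoeff z (i - k) : ℝ) : ℂ) else 0) :=
    hasSum_sum_of_ne_finset_zero fun i hi => by simp [hi]
  rw [h.unique h2]
  push_cast
  exact Finset.sum_congr rfl fun i hi => by simp [hi]

variable {p : ℝ} {Ω : Set (Phase d)}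

theorem correlationQuotient_le (hp : 0 < p) (hΩ : volume Ω < ∞) {T : L2 d →L[ℂ] L2 d}
    (hT : T ∈ admissible d) :
    correlationQuotient p Ω T ≤ (volume Ω).toReal ^ (1 / p) := by
  rw [correlationQuotient, div_le_iff₀ (pow_pos (hsNorm_pos hT.1 hT.2) 2), mul_comm, sq]
  exact localLpNorm_le hp hΩ (measurable_opConv hT.1 hT.1) (norm_opConv_le hT.1 hT.1)

theorem tendsto_correlationQuotient (hp : 0 < p) (hΩ : volume Ω < ∞) :
    Tendsto (fun R : ℕ => correlationQuotient p Ω (latticeProj (latticeBox d (R ^ 2 + R)))) atTop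
      (𝓝 ((volume Ω).toReal ^ (1 / p))) := by
  have hcard : ∀ N : ℕ, (0 : ℝ) < (latticeBox d N).card := fun N => by
    rw [card_latticeBox]
    positivity
  let F : ℕ → Phase d → ℂ := fun R z => (((latticeBox d (R ^ 2 + R)).card : ℝ)⁻¹ : ℝ) *
    opConv (latticeProj (latticeBox d (R ^ 2 + R)))
      (opReflect (latticeProj (latticeBox d (R ^ 2 + R)))) z
  have hn : ∀ R : ℕ, ‖((((latticeBox d (R ^ 2 + R)).card : ℝ)⁻¹ : ℝ) : ℂ)‖ =
      ((latticeBox d (R ^ 2 + R)).card : ℝ)⁻¹ := fun R => by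
    rw [Complex.norm_real, Real.norm_of_nonneg (inv_nonneg.2 (hcard _).le)]
  have hF : ∀ R, correlationQuotient p Ω (latticeProj (latticeBox d (R ^ 2 + R))) =
      localLpNorm p Ω (F R) := by
    intro R
    rw [localLpNorm_const_mul hp, hn, correlationQuotient, hsNorm_latticeProj_sq, inv_mul_eq_div]
  have hconst := localLpNorm_const (Ω := Ω) hp zero_le_one
  rw [one_mul] at hconst
  simp only [hF]
  rw [← hconst]
  refine tendsto_localLpNorm hp hΩ (C := 1) (fun R => ?_) (fun R z => ?_) fun z => ?_
  · exact (measurable_opConv (isHilbertSchmidt_latticeProj _)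
      (isHilbertSchmidt_latticeProj _)).const_mul _
  · rw [norm_mul, hn, inv_mul_eq_div]
    refine div_le_one_of_le₀ ?_ (hcard _).le
    rw [← hsNorm_latticeProj_sq, sq (hsNorm _)]
    exact norm_opConv_le (isHilbertSchmidt_latticeProj _) (isHilbertSchmidt_latticeProj _) z
  · have h := tendsto_latticeBox_average (fun _ => sq_nonneg _) (hasSum_gaborCoeff z)
    refine ((Complex.continuous_ofReal.tendsto _).comp h).congr fun R => ?_
    simp only [F, opConv_latticeProj, Function.comp_apply]
    rw [← Complex.ofReal_mul, inv_mul_eq_div]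
    rfl

theorem isLUB_correlationQuotient (hp : 0 < p) (hΩ : volume Ω < ∞) :
    IsLUB (correlationQuotient p Ω '' admissible d) ((volume Ω).toReal ^ (1 / p)) := by
  refine ⟨?_, fun B hB => le_of_tendsto' (tendsto_correlationQuotient hp hΩ) fun R => ?_⟩
  · rintro _ ⟨T, hT, rfl⟩
    exact correlationQuotient_le hp hΩ hT
  · refine hB ⟨_, latticeProj_mem_admissible _ (Finset.card_pos.1 ?_), rfl⟩
    rw [card_latticeBox]
    positivity

end Correlation

/-! ### The supremum in the total correlation problem is not attained -/

section NotAttained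

/-- An additive submonoid of a real vector space that is a neighbourhood of `0` is everything. -/
theorem mem_of_mem_nhds_zero {E : Type*} [NormedAddCommGroup E] [NormedSpace ℝ E]
    (G : AddSubmonoid E) (hG : (G : Set E) ∈ 𝓝 0) (u : E) : u ∈ G := by
  have h : Tendsto (fun n : ℕ => ((n : ℝ) + 1)⁻¹ • u) atTop (𝓝 0) := by
    have h1 := (tendsto_one_div_add_atTop_nhds_zero_nat (𝕜 := ℝ)).smul_const u
    simpa using h1
  obtain ⟨n, hn⟩ := (h.eventually hG).exists
  have h2 := G.nsmul_mem hn (n + 1)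
  rw [← Nat.cast_smul_eq_nsmul ℝ, smul_smul] at h2
  push_cast at h2
  rwa [mul_inv_cancel₀ (by positivity), one_smul] at h2

/-- The phase-space points whose operator shift maps `T` to a multiple of itself. -/
def stabilizer (T : L2 d →L[ℂ] L2 d) : AddSubmonoid (Phase d) where
  carrier := {u | ∃ c : ℂ, opShift u T = c • T}
  zero_mem' := ⟨1, by rw [opShift_zero, one_smul]⟩
  add_mem' := by
    rintro u v ⟨a, ha⟩ ⟨b, hb⟩
    exact ⟨b * a, by rw [← opShift_opShift, hb, opShift_smul, ha, smul_smul]⟩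

theorem norm_apply_tfShift {T : L2 d →L[ℂ] L2 d} (hT : IsHilbertSchmidt T) {u : Phase d}
    (hu : u ∈ stabilizer T) (f : L2 d) : ‖T (tfShift u f)‖ = ‖T f‖ := by
  by_cases h0 : T = 0
  · simp [h0]
  obtain ⟨c, hc⟩ := hu
  have h1 := congrArg hsNorm hc
  rw [hsNorm_opShift hT, hsNorm_smul] at h1
  have hc1 : ‖c‖ = 1 := by
    have h2 := hsNorm_pos hT h0
    field_simp at h1
    exact h1.symm
  have h3 := congrArg norm (DFunLike.congr_fun hc (tfShift u f))
  rw [opShift, ContinuousLinearMap.comp_apply, ContinuousLinearMap.comp_apply,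
    adjoint_tfShift_apply_tfShift, norm_tfShift, smul_apply, norm_smul, hc1, one_mul] at h3
  exact h3.symm

/-- An operator that is an eigenvector of all operator shifts has the same norm on all vectors of
the Gabor basis, so that it is not Hilbert–Schmidt unless it vanishes. -/
theorem eq_zero_of_stabilizer (hd : 1 ≤ d) {T : L2 d →L[ℂ] L2 d} (hT : IsHilbertSchmidt T)
    (h : ∀ u, u ∈ stabilizer T) : T = 0 := by
  have : Nonempty (Fin d) := ⟨⟨0, hd⟩⟩
  have h1 : ∀ k, ‖T (gabor d k)‖ ^ 2 = ‖T (window d)‖ ^ 2 := fun k => by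
    rw [gabor_apply, norm_apply_tfShift hT (h _)]
  have h2 := (isHilbertSchmidt_iff (gabor d) T).1 hT
  simp only [h1] at h2
  rw [← hsNorm_eq_zero_iff hT, hsNorm_eq (gabor d) hT]
  simp [h1, (summable_const_iff _).1 h2]

theorem opShift_ne_zero {T : L2 d →L[ℂ] L2 d} (hT : IsHilbertSchmidt T) (h0 : T ≠ 0)
    (z : Phase d) : opShift z T ≠ 0 := fun h => by
  have h1 := hsNorm_opShift hT z
  rw [(hsNorm_eq_zero_iff (isHilbertSchmidt_opShift hT z)).2 h] at h1
  exact (hsNorm_pos hT h0).ne h1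

theorem sub_mem_stabilizer {T : L2 d →L[ℂ] L2 d} (hT : IsHilbertSchmidt T) (h0 : T ≠ 0)
    {z w : Phase d} (hz : ‖opConv T (opReflect T) z‖ = hsNorm T * hsNorm T)
    (hw : ‖opConv T (opReflect T) w‖ = hsNorm T * hsNorm T) : z - w ∈ stabilizer T := by
  have key : ∀ v, ‖opConv T (opReflect T) v‖ = hsNorm T * hsNorm T →
      ∃ c : ℂ, opShift v T = c • ContinuousLinearMap.adjoint T := by
    intro v hv
    rw [opConv_opReflect] at hv
    refine exists_eq_smul_adjoint hT (isHilbertSchmidt_opShift hT v) h0 (opShift_ne_zero hT h0 v) ?_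
    rw [hv, hsNorm_opShift hT]
  obtain ⟨a, ha⟩ := key z hz
  obtain ⟨b, hb⟩ := key w hw
  have hb0 : b ≠ 0 := fun h => opShift_ne_zero hT h0 w (by rw [hb, h, zero_smul])
  refine ⟨a * b⁻¹, ?_⟩
  have h1 : opShift z T = (a * b⁻¹) • opShift w T := by
    rw [hb, smul_smul, inv_mul_cancel_right₀ hb0, ha]
  rw [sub_eq_neg_add, ← opShift_opShift, h1, opShift_smul, opShift_opShift, neg_add_cancel,
    opShift_zero]

/-- Equality would force equality in the Cauchy–Schwarz inequality on a set of positive measure. Its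
difference set, a neighbourhood of `0` by Steinhaus' theorem, consists of points whose operator
shift fixes `T` up to a scalar. -/
theorem correlationQuotient_ne (hd : 1 ≤ d) {p : ℝ} (hp : 0 < p) {Ω : Set (Phase d)}
    (hΩm : MeasurableSet Ω) (hΩ0 : 0 < volume Ω) (hΩ : volume Ω < ∞) {T : L2 d →L[ℂ] L2 d}
    (hT : T ∈ admissible d) : correlationQuotient p Ω T ≠ (volume Ω).toReal ^ (1 / p) := by
  intro h
  have hF := measurable_opConv hT.1 hT.1
  rw [correlationQuotient, div_eq_iff (pow_pos (hsNorm_pos hT.1 hT.2) 2).ne', mul_comm, sq] at h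
  have hae := ae_norm_eq_of_localLpNorm_eq hp hΩ hF (norm_opConv_le hT.1 hT.1) h
  let E : Set (Phase d) := Ω ∩ {z | ‖opConv T (opReflect T) z‖ = hsNorm T * hsNorm T}
  have hE : MeasurableSet E := hΩm.inter (measurableSet_eq_fun hF.norm measurable_const)
  have hE0 : volume E = volume Ω := by
    refine measure_congr ?_
    filter_upwards [(ae_restrict_iff' hΩm).1 hae] with z hz
    exact propext ⟨fun h => h.1, fun h => ⟨h, hz h⟩⟩
  have : (volume : Measure (Phase d)).IsAddHaarMeasure :=
    inferInstanceAs ((volume : Measure (Conf d)).prod volume).IsAddHaarMeasure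
  have hnhds := Measure.sub_mem_nhds_zero_of_addHaar_pos_ne_top volume E hE (by rwa [hE0])
    (by rw [hE0]; exact hΩ.ne)
  refine hT.2 (eq_zero_of_stabilizer hd hT.1 (mem_of_mem_nhds_zero _ (mem_of_superset hnhds ?_)))
  rintro _ ⟨z, hz, w, hw, rfl⟩
  exact sub_mem_stabilizer hT.1 hT.2 hz.2 hw.2

end NotAttained

end QHA

end

theorem proposition1p2 (d : ℕ) (hd : 1 ≤ d) (p : ℝ) (hp : 1 ≤ p)
    (Ω : Set (QHA.Phase d)) (hΩ : MeasurableSet Ω) (hΩ_pos : 0 < volume Ω)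
    (hΩ_fin : volume Ω < ∞) (S : QHA.L2 d →L[ℂ] QHA.L2 d) (hS : QHA.IsHilbertSchmidt S) :
    -- the `L^p(Ω)` norm of `T ⋆ Š` is a genuine (finite) one
    (∀ T : QHA.L2 d →L[ℂ] QHA.L2 d, QHA.IsHilbertSchmidt T →
      MemLp (QHA.opConv T (QHA.opReflect S)) (ENNReal.ofReal p) (volume.restrict Ω)) ∧
    -- the supremum in the generalized Husimi problem is attained
    (∃ T₀ ∈ QHA.admissible d,
      IsLUB (QHA.husimiQuotient p Ω S '' QHA.admissible d) (QHA.husimiQuotient p Ω S T₀)) ∧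
    -- the concentration functional is (sequentially) weakly continuous on the Hilbert space `𝒮²`
    (∀ (T : ℕ → QHA.L2 d →L[ℂ] QHA.L2 d) (T₀ : QHA.L2 d →L[ℂ] QHA.L2 d),
      (∀ n, QHA.IsHilbertSchmidt (T n)) → QHA.IsHilbertSchmidt T₀ → QHA.HSWeakTendsto T T₀ →
      Tendsto (fun n => QHA.husimiFunctional p Ω S (T n)) atTop
        (𝓝 (QHA.husimiFunctional p Ω S T₀))) ∧
    -- the supremum in the total correlation problem is `|Ω|^{1/p}`, and it is not attained
    (∀ T : QHA.L2 d →L[ℂ] QHA.L2 d, QHA.IsHilbertSchmidt T →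
      MemLp (QHA.opConv T (QHA.opReflect T)) (ENNReal.ofReal p) (volume.restrict Ω)) ∧
    IsLUB (QHA.correlationQuotient p Ω '' QHA.admissible d) ((volume Ω).toReal ^ (1 / p)) ∧
    ¬ ∃ T₀ ∈ QHA.admissible d,
      QHA.correlationQuotient p Ω T₀ = (volume Ω).toReal ^ (1 / p) := by
  have hp0 : 0 < p := zero_lt_one.trans_le hp
  exact ⟨fun T hT => QHA.memLp_opConv hT hS hΩ_fin _,
    QHA.exists_isLUB_husimiQuotient hp0 hΩ_fin hS,
    fun T T₀ hT hT₀ h => QHA.tendsto_husimiFunctional hp0 hΩ_fin hS hT hT₀ h,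
    fun T hT => QHA.memLp_opConv hT hT hΩ_fin _,
    QHA.isLUB_correlationQuotient hp0 hΩ_fin,
    fun ⟨_, hT, h⟩ => QHA.correlationQuotient_ne hd hp0 hΩ hΩ_pos hΩ_fin hT h⟩
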